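/- **Notation.** A Maya diagram is a set $M\subset\mathbb Z$ such that $K_M^+=\{m\in M: m\ge 0\}$ and $K_M^-=\{m\in\mathbb Z\setminus M: m<0\}$ are finite. Put $\sigma_M=\#K_M^+-\#K_M^-$, $M+n=\{m+n:m\in M\}$ and $I_M=\mathbb Z\setminus M$; let $f_m(M)$ be $M\cup\{m\}$ if $m\notin M$ and $M\setminus\{m\}$ if $m\in M$. If $m_1>m_2>\cdots$ is the decreasing enumeration of $M$, the partition of $M$ is $\lambda_i=m_i+i-\sigma_M$ $(i\ge1)$; put $M^{(\lambda)}=\{\lambda_i-i: i\ge 1\}$. An integer $q\ge 1$ is a critical degree of $M$ (and $M$ is a $q$-core) if $M\subset M+q$. Let $D^{(\lambda)}$ be the set of critical degrees of $M^{(\lambda)}$, and let $R^{(\lambda)}=\operatorname{span}\{z^q: q\in D^{(\lambda)}\}\subset\mathbb K[z]$, a (non-unital) subalgebra, where $\mathbb K=\mathbb R$ or $\mathbb C$. Let $H_n(x)=(-1)^ne^{x^2}\frac{d^n}{dx^n}e^{-x^2}$ and $\tilde H_n(x)=e^{-x^2}\frac{d^n}{dx^n}e^{x^2}$. Let $s_1>\dots>s_p$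 be the elements of $K_M^-$ and $t_1<\dots<t_r$ those of $K_M^+$, and put $$H_M=e^{-px^2}\operatorname{Wr}[e^{x^2}\tilde H_{-s_1-1},\dots,e^{x^2}\tilde H_{-s_p-1},H_{t_1},\dots,H_{t_r}],\qquad \hat H_M=\frac{(-1)^{pr}H_M}{\prod_{i<j}2(s_i-s_j)\prod_{i<j}2(t_j-t_i)}.$$ On $U_M=\{x\in\mathbb R:\hat H_M(x)\ne0\}$ let $$\psi_{M,m}=e^{\epsilon_M(m)x^2/2}\,\hat H_{f_m(M)}/\hat H_M\quad(m\in\mathbb Z),$$ where $\epsilon_M(m)=-1$ if $m\notin M$ and $+1$ if $m\in M$; the bound states are the $\psi_{M,m}$ with $m\in I_M$. For a critical degree $q$, with $(M+q)\ominus M=(M+q)\setminus M=\{k_1,\dots,k_n\}$, the ladder operator (annihilator) $L_M^{(q)}$ is the differential operator $$L_M^{(q)}[y]=\frac{\operatorname{Wr}[\psi_{M,k_1},\dots,\psi_{M,k_n},y]}{\operatorname{Wr}[\psi_{M,k_1},\dots,\psi_{M,k_n}]}$$ on the space $C^\infty(U_M,\mathbb K)$. The ring of annihilators of $M$ is the (non-unital)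 $\mathbb K$-algebra of operators on $C^\infty(U_M,\mathbb K)$ generated by the $L_M^{(q)}$, $q$ a critical degree of $M$. **Statement.** Let $M$ be a Maya diagram and $\lambda$ its partition. 1. $D^{(\lambda)}$ is the set of critical degrees of $M$, and for every $q\in D^{(\lambda)}$ the Wronskian in the denominator of $L_M^{(q)}$ has no zero on $U_M$. 2. For all $q\in D^{(\lambda)}$ and $m\in I_M$, $$L_M^{(q)}\psi_{M,m}=2^q\,\gamma_M^{(q)}(m)\,\psi_{M,m-q},\qquad \gamma_M^{(q)}(x)=\prod_{k\in(M+q)\setminus M}(x-k).$$ 3. The ring of annihilators of $M$ is the linear span of the $L_M^{(q)}$, $q\in D^{(\lambda)}$; it is commutative, and there is an isomorphism of $\mathbb K$-algebras from it onto $R^{(\lambda)}$ that sends $L_M^{(q)}$ to $z^q$ for every $q\in D^{(\lambda)}$. -/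

import Mathlib

open scoped ContDiff Polynomial Pointwise

noncomputable section

namespace MayaLadder

/-! ### Maya diagrams -/

/-- A Maya diagram: a set of integers with finitely many non-negative members
and finitely many negative non-members. -/
structure MayaDiagram where
  carrier : Set ℤ
  finite_pos : {m : ℤ | m ∈ carrier ∧ 0 ≤ m}.Finite
  finite_neg : {m : ℤ | m ∉ carrier ∧ m < 0}.Finite

namespace MayaDiagram

/-- `K_M^+`, the non-negative members of `M`. -/
def KPos (M : MayaDiagram) : Finset ℤ := M.finite_pos.toFinset

/-- `K_M^-`, the negative non-members of `M`. -/
def KNeg (M : MayaDiagram) : Finset ℤ := M.finite_neg.toFinset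

/-- The index `σ_M = #K_M^+ - #K_M^-`. -/
def index (M : MayaDiagram) : ℤ := (M.KPos.card : ℤ) - (M.KNeg.card : ℤ)

/-- A set differing from a Maya diagram in finitely many places is a Maya diagram. -/
theorem finite_of_symmDiff (M : MayaDiagram) (S : Set ℤ)
    (h : (symmDiff S M.carrier).Finite) :
    {m : ℤ | m ∈ S ∧ 0 ≤ m}.Finite ∧ {m : ℤ | m ∉ S ∧ m < 0}.Finite := by
  constructor
  · refine (M.finite_pos.union h).subset ?_
    rintro m ⟨hm, h0⟩
    by_cases hM : m ∈ M.carrier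
    · exact Or.inl ⟨hM, h0⟩
    · exact Or.inr (Or.inl ⟨hm, hM⟩)
  · refine (M.finite_neg.union h).subset ?_
    rintro m ⟨hm, h0⟩
    by_cases hM : m ∈ M.carrier
    · exact Or.inr (Or.inr ⟨hM, hm⟩)
    · exact Or.inl ⟨hM, h0⟩

/-- The flip `f_k` at position `k`: it removes `k` if `k ∈ M` and inserts `k` otherwise. -/
def flip (M : MayaDiagram) (k : ℤ) : MayaDiagram :=
  have h := M.finite_of_symmDiff (symmDiff M.carrier {k}) (by
    rw [symmDiff_comm M.carrier, symmDiff_symmDiff_cancel_right]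
    exact Set.finite_singleton k)
  ⟨symmDiff M.carrier {k}, h.1, h.2⟩

/-- The set `(M + n) ⊖ M` is finite. -/
theorem finite_shift_symmDiff (M : MayaDiagram) (n : ℤ) :
    (symmDiff {m : ℤ | m - n ∈ M.carrier} M.carrier).Finite := by
  have hp := M.finite_pos
  have hn := M.finite_neg
  have hp' : ((fun m => m + n) '' {m : ℤ | m ∈ M.carrier ∧ 0 ≤ m}).Finite := hp.image _
  have hn' : ((fun m => m + n) '' {m : ℤ | m ∉ M.carrier ∧ m < 0}).Finite := hn.image _
  refine ((((hp.union hn).union (hp'.union hn')).union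
    (Set.finite_Icc (-|n|) |n|))).subset ?_
  intro m hm
  have habs := abs_le.mp (le_refl |n|)
  by_cases h1 : m ∈ Set.Icc (-|n|) |n|
  · exact Or.inr h1
  · left
    rw [Set.mem_Icc, not_and_or, not_le, not_le] at h1
    rcases hm with ⟨ha, hb⟩ | ⟨ha, hb⟩
    · rcases h1 with h1 | h1
      · exact Or.inl (Or.inr ⟨hb, by omega⟩)
      · exact Or.inr (Or.inl ⟨m - n, ⟨ha, by omega⟩, by simp⟩)
    · rcases h1 with h1 | h1
      · exact Or.inr (Or.inr ⟨m - n, ⟨hb, by omega⟩, by simp⟩)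
      · exact Or.inl (Or.inl ⟨ha, by omega⟩)

/-- The finite set `K_M^{(n)} = (M + n) ⊖ M`. -/
def ladderSet (M : MayaDiagram) (n : ℤ) : Finset ℤ := (M.finite_shift_symmDiff n).toFinset

/-- The finite set `(M + n) \ M`. -/
def shiftDiff (M : MayaDiagram) (n : ℤ) : Finset ℤ :=
  ((M.finite_shift_symmDiff n).subset
    (fun _ hm => Or.inl hm : {m : ℤ | m - n ∈ M.carrier} \ M.carrier ⊆ _)).toFinset

/-- `I_M = ℤ \ M`, the labels of the bound states. -/
def boundLabels (M : MayaDiagram) : Set ℤ := M.carrierᶜ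

/-- `m_i`, the `i`-th largest element of `M` (`i = 1, 2, …`): the unique element of `M`
that has exactly `i - 1` larger elements of `M`. -/
def enum (M : MayaDiagram) (i : ℕ) : ℤ :=
  sSup {m : ℤ | m ∈ M.carrier ∧ {k : ℤ | k ∈ M.carrier ∧ m < k}.ncard + 1 = i}

/-- The partition `λ_i = m_i + i - σ_M` (`i = 1, 2, …`) that corresponds to `M`. -/
def partition (M : MayaDiagram) (i : ℕ) : ℤ := M.enum i + i - M.index

end MayaDiagram

/-! ### Critical degrees -/

/-- `M^{(λ)} = {λ_i - i : i = 1, 2, …}`. -/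
def mayaSet (lam : ℕ → ℤ) : Set ℤ := {m | ∃ i : ℕ, 1 ≤ i ∧ m = lam i - i}

/-- The critical degrees of a set of integers `S`: the `q = 1, 2, …` with `S ⊆ S + q`. -/
def criticalDegrees (S : Set ℤ) : Set ℕ := {q | 0 < q ∧ ∀ m ∈ S, m - (q : ℤ) ∈ S}

/-- `D^{(λ)}`. -/
def critDeg (lam : ℕ → ℤ) : Set ℕ := criticalDegrees (mayaSet lam)

theorem critDeg_add {lam : ℕ → ℤ} {a b : ℕ} (ha : a ∈ critDeg lam) (hb : b ∈ critDeg lam) :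
    a + b ∈ critDeg lam := by
  refine ⟨Nat.add_pos_left ha.1 b, fun m hm => ?_⟩
  have := hb.2 _ (ha.2 m hm)
  rwa [sub_sub, ← Nat.cast_add] at this

/-- `R^{(λ)} = span {z^q : q ∈ D^{(λ)}}`, a (non-unital) subalgebra of `𝕜[z]`. -/
def critRing (𝕜 : Type*) [Field 𝕜] (lam : ℕ → ℤ) : NonUnitalSubalgebra 𝕜 𝕜[X] :=
  { Submodule.span 𝕜 {p : 𝕜[X] | ∃ q ∈ critDeg lam, p = Polynomial.X ^ q} with
    mul_mem' := by
      intro a b ha hb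
      have h := Submodule.mul_mem_mul ha hb
      rw [Submodule.span_mul_span] at h
      refine Submodule.span_mono ?_ h
      rintro _ ⟨_, ⟨q₁, h₁, rfl⟩, _, ⟨q₂, h₂, rfl⟩, rfl⟩
      exact ⟨q₁ + q₂, critDeg_add h₁ h₂, (pow_add _ _ _).symm⟩ }

/-! ### Hermite functions and pseudo-Wronskians -/

/-- The Hermite polynomial `H_n(x) = (-1)^n e^{x²} (d/dx)^n e^{-x²}`. -/
def hermiteH (n : ℕ) (x : ℝ) : ℝ :=
  (-1) ^ n * Real.exp (x ^ 2) * iteratedDeriv n (fun t : ℝ => Real.exp (-t ^ 2)) x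

/-- The conjugate Hermite polynomial `H̃_n(x) = e^{-x²} (d/dx)^n e^{x²}`. -/
def hermiteConj (n : ℕ) (x : ℝ) : ℝ :=
  Real.exp (-x ^ 2) * iteratedDeriv n (fun t : ℝ => Real.exp (t ^ 2)) x

/-- The Wronskian determinant of functions on the line. -/
def wronskian {n : ℕ} (f : Fin n → ℝ → ℝ) (x : ℝ) : ℝ :=
  (Matrix.of fun i j : Fin n => iteratedDeriv (j : ℕ) (f i) x).det

theorem contDiff_iteratedDeriv {f : ℝ → ℝ} (hf : ContDiff ℝ ∞ f) (k : ℕ) :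
    ContDiff ℝ ∞ (iteratedDeriv k f) := by
  rw [contDiff_infty]
  intro n
  rw [iteratedDeriv_eq_iterate]
  exact ContDiff.iterate_deriv' n k (contDiff_infty.1 hf (n + k))

theorem contDiff_wronskian {n : ℕ} {f : Fin n → ℝ → ℝ} (hf : ∀ i, ContDiff ℝ ∞ (f i)) :
    ContDiff ℝ ∞ (wronskian f) := by
  unfold wronskian
  simp only [Matrix.det_apply, Matrix.of_apply]
  refine ContDiff.sum fun s _ => ContDiff.const_smul _ ?_
  exact contDiff_prod fun i _ => contDiff_iteratedDeriv (hf _) _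

theorem contDiff_hermiteH (n : ℕ) : ContDiff ℝ ∞ (hermiteH n) := by
  unfold hermiteH
  have h := contDiff_iteratedDeriv (f := fun t : ℝ => Real.exp (-t ^ 2)) (by fun_prop) n
  fun_prop

theorem contDiff_hermiteConj (n : ℕ) : ContDiff ℝ ∞ (hermiteConj n) := by
  unfold hermiteConj
  have h := contDiff_iteratedDeriv (f := fun t : ℝ => Real.exp (t ^ 2)) (by fun_prop) n
  fun_prop

namespace MayaDiagram

/-- The elements `s_1 > s_2 > ⋯ > s_p` of `K_M^-`, in decreasing order. -/
def negEnum (M : MayaDiagram) (i : Fin M.KNeg.card) : ℤ := M.KNeg.orderEmbOfFin rfl i.rev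

/-- The elements `t_1 < t_2 < ⋯ < t_q` of `K_M^+`, in increasing order. -/
def posEnum (M : MayaDiagram) (j : Fin M.KPos.card) : ℤ := M.KPos.orderEmbOfFin rfl j

/-- The functions `e^{x²} H̃_{-s_1-1}, …, e^{x²} H̃_{-s_p-1}, H_{t_1}, …, H_{t_q}`. -/
def seed (M : MayaDiagram) : Fin (M.KNeg.card + M.KPos.card) → ℝ → ℝ :=
  Fin.append
    (fun i x => Real.exp (x ^ 2) * hermiteConj (-M.negEnum i - 1).toNat x)
    (fun j x => hermiteH (M.posEnum j).toNat x)

/-- The pseudo-Wronskian `H_M = e^{-p x²} Wr[…]`. -/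
def pseudoWronskian (M : MayaDiagram) (x : ℝ) : ℝ :=
  Real.exp (-(M.KNeg.card : ℝ) * x ^ 2) * wronskian M.seed x

/-- The normalized pseudo-Wronskian
`Ĥ_M = (-1)^{pq} H_M / (∏_{i<j} 2 (s_i - s_j) ∏_{i<j} 2 (t_j - t_i))`. -/
def hatH (M : MayaDiagram) (x : ℝ) : ℝ :=
  (-1) ^ (M.KNeg.card * M.KPos.card) * M.pseudoWronskian x /
    ((∏ i, ∏ j ∈ Finset.Ioi i, 2 * ((M.negEnum i : ℝ) - (M.negEnum j : ℝ))) *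
      (∏ i, ∏ j ∈ Finset.Ioi i, 2 * ((M.posEnum j : ℝ) - (M.posEnum i : ℝ))))

theorem contDiff_hatH (M : MayaDiagram) : ContDiff ℝ ∞ M.hatH := by
  have h : ContDiff ℝ ∞ (wronskian M.seed) := by
    refine contDiff_wronskian fun i => ?_
    unfold seed
    refine Fin.addCases (fun i => ?_) (fun j => ?_) i
    · simp only [Fin.append_left]
      have := contDiff_hermiteConj (-M.negEnum i - 1).toNat
      fun_prop
    · simp only [Fin.append_right]
      exact contDiff_hermiteH _
  unfold hatH pseudoWronskian
  fun_prop

/-- The domain of the rational extension attached to `M`: the complement of the real zeros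
of `Ĥ_M`. -/
def domain (M : MayaDiagram) : TopologicalSpace.Opens ℝ :=
  ⟨{x | M.hatH x ≠ 0}, isOpen_ne_fun M.contDiff_hatH.continuous continuous_const⟩

end MayaDiagram

/-! ### Smooth functions on an open subset of the line -/

section Smooth

variable (𝕜 : Type*) [RCLike 𝕜] (U : TopologicalSpace.Opens ℝ)

/-- Extension by zero of a function on `U`. -/
def ext0 {𝕜 : Type*} [RCLike 𝕜] {U : TopologicalSpace.Opens ℝ} (f : U → 𝕜) : ℝ → 𝕜 :=
  Function.extend Subtype.val f 0

theorem ext0_apply {𝕜 : Type*} [RCLike 𝕜] {U : TopologicalSpace.Opens ℝ} (f : U → 𝕜) (x : U) :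
    ext0 f (x : ℝ) = f x :=
  Subtype.val_injective.extend_apply f 0 x

/-- A function on `U` which is the restriction of `g` agrees with `g` on `U`. -/
theorem ext0_eqOn {𝕜 : Type*} [RCLike 𝕜] {U : TopologicalSpace.Opens ℝ} {f : U → 𝕜} {g : ℝ → 𝕜}
    (h : ∀ x : U, f x = g x) : Set.EqOn (ext0 f) g U := by
  intro x hx
  exact (ext0_apply f ⟨x, hx⟩).trans (h ⟨x, hx⟩)

/-- The algebra `C^∞(U, 𝕜)`. -/
def Smooth : Subalgebra 𝕜 (U → 𝕜) where
  carrier := {f | ContDiffOn ℝ ∞ (ext0 f) U}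
  mul_mem' := by
    intro f g hf hg
    exact (hf.mul hg).congr (ext0_eqOn fun x => by
      simp only [Pi.mul_apply, ext0_apply])
  add_mem' := by
    intro f g hf hg
    exact (hf.add hg).congr (ext0_eqOn fun x => by
      simp only [Pi.add_apply, ext0_apply])
  algebraMap_mem' := by
    intro c
    exact (contDiffOn_const (c := c)).congr (ext0_eqOn fun x => by simp)

variable {𝕜 U}

theorem Smooth.differentiableAt (f : Smooth 𝕜 U) (x : U) :
    DifferentiableAt ℝ (ext0 (f : U → 𝕜)) x :=
  (f.2.differentiableOn (by simp)).differentiableAt (U.isOpen.mem_nhds x.2)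

theorem Smooth.eventually_eq {f : U → 𝕜} {g : ℝ → 𝕜} (h : ∀ x : U, f x = g x) (x : U) :
    ext0 f =ᶠ[nhds (x : ℝ)] g :=
  (ext0_eqOn h).eventuallyEq_of_mem (U.isOpen.mem_nhds x.2)

variable (𝕜 U)

/-- Differentiation `d/dx` on `C^∞(U, 𝕜)`. -/
def Dx : Module.End 𝕜 (Smooth 𝕜 U) where
  toFun f := ⟨fun x => deriv (ext0 (f : U → 𝕜)) x, by
    have h : ContDiffOn ℝ ∞ (deriv (ext0 (f : U → 𝕜))) U :=
      f.2.deriv_of_isOpen U.isOpen (by simp)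
    exact h.congr (ext0_eqOn fun x => rfl)⟩
  map_add' f g := by
    ext x
    have h : ext0 ((f + g : Smooth 𝕜 U) : U → 𝕜) =ᶠ[nhds (x : ℝ)]
        ext0 (f : U → 𝕜) + ext0 (g : U → 𝕜) :=
      Smooth.eventually_eq (fun y => by simp [ext0_apply]) x
    change deriv (ext0 ((f + g : Smooth 𝕜 U) : U → 𝕜)) x =
      deriv (ext0 (f : U → 𝕜)) x + deriv (ext0 (g : U → 𝕜)) x
    rw [h.deriv_eq, deriv_add (Smooth.differentiableAt f x) (Smooth.differentiableAt g x)]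
  map_smul' c f := by
    ext x
    have h : ext0 ((c • f : Smooth 𝕜 U) : U → 𝕜) =ᶠ[nhds (x : ℝ)]
        fun y => c * ext0 (f : U → 𝕜) y :=
      Smooth.eventually_eq (fun y => by simp [ext0_apply]) x
    change deriv (ext0 ((c • f : Smooth 𝕜 U) : U → 𝕜)) x = c * deriv (ext0 (f : U → 𝕜)) x
    rw [h.deriv_eq, deriv_const_mul _ (Smooth.differentiableAt f x)]

variable {𝕜 U}

/-- The matrix `(f_i^{(j)})` of derivatives. -/
def wrMatrix {n : ℕ} (f : Fin n → Smooth 𝕜 U) : Matrix (Fin n) (Fin n) (Smooth 𝕜 U) :=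
  Matrix.of fun i j => (Dx 𝕜 U ^ (j : ℕ)) (f i)

/-- The Wronskian determinant of elements of `C^∞(U, 𝕜)`. -/
def wr {n : ℕ} (f : Fin n → Smooth 𝕜 U) : Smooth 𝕜 U := (wrMatrix f).det

theorem wrMatrix_snoc {n : ℕ} (f : Fin n → Smooth 𝕜 U) (y : Smooth 𝕜 U) :
    wrMatrix (Fin.snoc f y : Fin (n + 1) → Smooth 𝕜 U) =
      (wrMatrix (Fin.snoc f 0 : Fin (n + 1) → Smooth 𝕜 U)).updateRow (Fin.last n)
        (fun j => (Dx 𝕜 U ^ (j : ℕ)) y) := by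
  ext i j : 2
  refine Fin.lastCases ?_ (fun i => ?_) i
  · simp [wrMatrix]
  · rw [Matrix.updateRow_ne (Fin.castSucc_lt_last i).ne]
    simp [wrMatrix]

/-- The differential operator `y ↦ Wr[f_1, …, f_n, y] / Wr[f_1, …, f_n]` on `C^∞(U, 𝕜)`.
It is meant for families whose Wronskian has no zero on `U`, i.e. is a unit of `C^∞(U, 𝕜)`;
otherwise `Ring.inverse` is zero. -/
def wrOperator {n : ℕ} (f : Fin n → Smooth 𝕜 U) : Module.End 𝕜 (Smooth 𝕜 U) where
  toFun y := Ring.inverse (wr f) * wr (Fin.snoc f y : Fin (n + 1) → Smooth 𝕜 U)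
  map_add' y z := by
    have h : (fun j : Fin (n + 1) => (Dx 𝕜 U ^ (j : ℕ)) (y + z)) =
        (fun j : Fin (n + 1) => (Dx 𝕜 U ^ (j : ℕ)) y) +
          fun j : Fin (n + 1) => (Dx 𝕜 U ^ (j : ℕ)) z := by
      funext j; simp
    simp only [wr]
    rw [wrMatrix_snoc f (y + z), h, Matrix.det_updateRow_add, mul_add,
      ← wrMatrix_snoc, ← wrMatrix_snoc]
  map_smul' c y := by
    have h : (fun j : Fin (n + 1) => (Dx 𝕜 U ^ (j : ℕ)) (c • y)) =
        (algebraMap 𝕜 (Smooth 𝕜 U) c) • fun j : Fin (n + 1) => (Dx 𝕜 U ^ (j : ℕ)) y := by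
      funext j
      rw [Pi.smul_apply, smul_eq_mul, map_smul, Algebra.smul_def]
    simp only [wr, RingHom.id_apply]
    rw [wrMatrix_snoc f (c • y), h, Matrix.det_updateRow_smul, ← wrMatrix_snoc,
      Algebra.smul_def, mul_left_comm]

end Smooth

/-! ### Bound states and ladder operators of a rational extension -/

namespace MayaDiagram

variable (𝕜 : Type*) [RCLike 𝕜] (M : MayaDiagram)

open scoped Classical in
/-- `ε_M(m)`: `+1` if `m ∈ M` and `-1` otherwise. -/
def eps (m : ℤ) : ℝ := if m ∈ M.carrier then 1 else -1

/-- The eigenfunction `ψ_{M,m} = e^{ε_M(m) x²/2} Ĥ_{f_m(M)} / Ĥ_M`. -/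
def psi (m : ℤ) : Smooth 𝕜 M.domain :=
  ⟨fun x => ((Real.exp (M.eps m * (x : ℝ) ^ 2 / 2) * (M.flip m).hatH x / M.hatH x : ℝ) : 𝕜), by
    have h : ContDiffOn ℝ ∞
        (fun x : ℝ => Real.exp (M.eps m * x ^ 2 / 2) * (M.flip m).hatH x / M.hatH x)
        M.domain := by
      have h₁ := (M.flip m).contDiff_hatH
      refine ContDiffOn.div ?_ M.contDiff_hatH.contDiffOn fun x hx => hx
      exact ContDiff.contDiffOn (by fun_prop)
    have h₂ : ContDiffOn ℝ ∞ (fun x : ℝ =>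
        ((Real.exp (M.eps m * x ^ 2 / 2) * (M.flip m).hatH x / M.hatH x : ℝ) : 𝕜))
        M.domain :=
      (RCLike.ofRealCLM (K := 𝕜)).contDiff.comp_contDiffOn h
    exact h₂.congr (ext0_eqOn fun x => rfl)⟩

/-- The operator `A_{M,K}[y] = Wr[ψ_{M,k_1}, …, ψ_{M,k_p}, y] / Wr[ψ_{M,k_1}, …, ψ_{M,k_p}]`,
where `K = {k_1 < ⋯ < k_p}` (the order of the `k_i` is immaterial). -/
def intertwiner (K : Finset ℤ) : Module.End 𝕜 (Smooth 𝕜 M.domain) :=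
  wrOperator fun i : Fin K.card => M.psi 𝕜 (K.orderEmbOfFin rfl i)

/-- The ladder operator `L_M^{(n)} = A_{M,(M+n) ⊖ M}`. -/
def ladder (n : ℤ) : Module.End 𝕜 (Smooth 𝕜 M.domain) := M.intertwiner 𝕜 (M.ladderSet n)

/-- `γ_M^{(n)}(x) = ∏_{k ∈ (M+n) \ M} (x - k)`. -/
def gamma (n : ℤ) (x : 𝕜) : 𝕜 := ∏ k ∈ M.shiftDiff n, (x - (k : 𝕜))

/-- The ring of annihilation operators of the rational extension attached to `M`: the
(non-unital) ring of operators generated over `𝕜` by the `L_M^{(q)}`, where `q` runs through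
the critical degrees of `M`. -/
def annihilatorRing : NonUnitalSubalgebra 𝕜 (Module.End 𝕜 (Smooth 𝕜 M.domain)) :=
  NonUnitalAlgebra.adjoin 𝕜
    {A | ∃ q ∈ criticalDegrees M.carrier, A = M.ladder 𝕜 (q : ℤ)}

end MayaDiagram

end MayaLadder

end

open MayaLadder

open scoped ContDiff Polynomial Pointwise

noncomputable section

namespace MayaLadder

/-! ### Differential operators over a commutative ring with a derivation -/

section DiffOps

variable {k R : Type*} [CommRing k] [CommRing R] [Algebra k R] (D : Module.End k R)

/-! The normalization of `Ĥ_M` makes it invariant under `M ↦ M + 1` (`hatH_shift_one`). After a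
large translation no negative integer is missing, so `Ĥ_M` is a Wronskian of Hermite polynomials
divided by a Vandermonde product (`IsLabelling.hatH_eq`). Hence a bound state `ψ_{M,m}` is a
constant times the Gaussian times the Darboux-Crum transform of one Hermite polynomial
(`IsLabelling.psi_eq`).

For a critical degree `q`, the labels of `M + q` are those of `M` followed by `(M + q) \ M`. By
Crum's composition formula (`ringWr_append`, `ringWrOp_comp_ringWrOp`) the ladder operator therefore
turns the transform attached to `M` into the one attached to `M + q`. Since `Ĥ_{M+q} = Ĥ_M`, the
result is proportional to `ψ_{M,m-q}`, and the ratio of the Vandermonde factors is `2^q γ(m)`. The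
same factorization exhibits the denominator as a divisor of a function without zeros on `U_M`.

For the ring, `L^{(a)} L^{(b)}` and `L^{(a+b)}` are both monic of order `a + b` and annihilate the
same `a + b` bound states, whose Wronskian is invertible; so they are equal (`ladder_mul`).
Operators of distinct orders are linearly independent because `U_M` is nonempty, which follows from
the asymptotics of Hermite Wronskians. Thus `z^q ↦ L^{(q)}` is an isomorphism, and commutativity is
inherited from `𝕜[z]`. -/

/-- The `R`-module of operators `∑_{j < n} a_j D^j`. -/
def lowOps (n : ℕ) : Submodule R (R → R) :=
  Submodule.span R (Set.range fun j : Fin n => (⇑(D ^ (j : ℕ)) : R → R))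

/-- The operators `D^n + ∑_{j < n} a_j D^j`. -/
def IsMonicOp (n : ℕ) (P : R → R) : Prop := P - ⇑(D ^ n) ∈ lowOps D n

/-- The Wronskian of a family of elements of a ring with derivation. -/
def ringWr {n : ℕ} (f : Fin n → R) : R :=
  (Matrix.of fun i j : Fin n => (D ^ (j : ℕ)) (f i)).det

variable {D}

theorem pow_mem_lowOps {j n : ℕ} (h : j < n) : (⇑(D ^ j) : R → R) ∈ lowOps D n :=
  Submodule.subset_span ⟨⟨j, h⟩, rfl⟩

theorem lowOps_mono {m n : ℕ} (h : m ≤ n) : lowOps D m ≤ lowOps D n := by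
  refine Submodule.span_le.2 ?_
  rintro _ ⟨j, rfl⟩
  exact pow_mem_lowOps (j.2.trans_le h)

theorem IsMonicOp.mem_lowOps {m n : ℕ} {P : R → R} (hP : IsMonicOp D m P) (h : m < n) :
    P ∈ lowOps D n := by
  have := (lowOps D n).add_mem (lowOps_mono h.le hP) (pow_mem_lowOps h)
  simpa using this

theorem isMonicOp_pow (n : ℕ) : IsMonicOp D n ⇑(D ^ n) := by
  simp [IsMonicOp]

theorem exists_coeff_of_mem_lowOps {n : ℕ} {P : R → R} (hP : P ∈ lowOps D n) :
    ∃ a : ℕ → R, ∀ y, P y = ∑ l ∈ Finset.range n, a l * (D ^ l) y := by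
  obtain ⟨c, hc⟩ := (Submodule.mem_span_range_iff_exists_fun R).1 hP
  refine ⟨fun l => if h : l < n then c ⟨l, h⟩ else 0, fun y => ?_⟩
  rw [← hc, Finset.sum_range]
  simp

theorem IsMonicOp.exists_coeff {n : ℕ} {P : R → R} (hP : IsMonicOp D n P) :
    ∃ a : ℕ → R, ∀ y, P y = (D ^ n) y + ∑ l ∈ Finset.range n, a l * (D ^ l) y := by
  obtain ⟨a, ha⟩ := exists_coeff_of_mem_lowOps hP
  refine ⟨a, fun y => ?_⟩
  rw [← ha y]
  simp

theorem deriv_comp_mem_lowOps (hD : ∀ a b, D (a * b) = a * D b + b * D a) {n : ℕ} {P : R → R}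
    (hP : P ∈ lowOps D n) : (fun y => D (P y)) ∈ lowOps D (n + 1) := by
  induction hP using Submodule.span_induction with
  | mem P h =>
    obtain ⟨j, rfl⟩ := h
    have := pow_mem_lowOps (D := D) (Nat.succ_lt_succ j.2)
    rw [pow_succ'] at this
    exact this
  | zero =>
    convert (lowOps D (n + 1)).zero_mem using 1
    funext y
    simp
  | add P Q _ _ h₁ h₂ =>
    convert (lowOps D (n + 1)).add_mem h₁ h₂ using 1
    funext y
    simp
  | smul a P hP h =>
    have h₂ := (lowOps D (n + 1)).add_mem ((lowOps D (n + 1)).smul_mem a h)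
      ((lowOps D (n + 1)).smul_mem (D a) (lowOps_mono n.le_succ hP))
    convert h₂ using 1
    funext y
    simp [hD, mul_comm]

theorem IsMonicOp.add_mem {n : ℕ} {P Q : R → R} (hP : IsMonicOp D n P) (hQ : Q ∈ lowOps D n) :
    IsMonicOp D n (P + Q) := by
  have := (lowOps D n).add_mem hP hQ
  rwa [← add_sub_right_comm] at this

theorem IsMonicOp.deriv_comp (hD : ∀ a b, D (a * b) = a * D b + b * D a) {n : ℕ} {P : R → R}
    (hP : IsMonicOp D n P) : IsMonicOp D (n + 1) fun y => D (P y) := by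
  have := deriv_comp_mem_lowOps hD hP
  unfold IsMonicOp
  convert this using 1
  funext y
  simp [pow_succ']

theorem IsMonicOp.pow_comp (hD : ∀ a b, D (a * b) = a * D b + b * D a) {n : ℕ} {P : R → R}
    (hP : IsMonicOp D n P) (j : ℕ) : IsMonicOp D (j + n) fun y => (D ^ j) (P y) := by
  induction j with
  | zero => simpa using hP
  | succ j ih =>
    have := ih.deriv_comp hD
    rw [add_right_comm]
    simpa [pow_succ'] using this

theorem IsMonicOp.comp (hD : ∀ a b, D (a * b) = a * D b + b * D a) {m n : ℕ} {P Q : R → R}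
    (hQ : IsMonicOp D m Q) (hP : IsMonicOp D n P) : IsMonicOp D (m + n) fun y => Q (P y) := by
  obtain ⟨a, ha⟩ := hQ.exists_coeff
  have h : (fun y => Q (P y)) = (fun y => (D ^ m) (P y)) +
      ∑ l ∈ Finset.range m, a l • fun y => (D ^ l) (P y) := by
    funext y
    simp [ha]
  rw [h]
  refine (hP.pow_comp hD m).add_mem (Submodule.sum_mem _ fun l hl => Submodule.smul_mem _ _ ?_)
  exact (hP.pow_comp hD l).mem_lowOps (by simpa using hl)

/-- The Wronskian can be computed with any sequence of monic operators of orders `0, 1, 2, …`. -/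
theorem det_monicOps {n : ℕ} (P : ℕ → R → R) (hP : ∀ j, IsMonicOp D j (P j)) (f : Fin n → R) :
    (Matrix.of fun i j : Fin n => P j (f i)).det = ringWr D f := by
  choose a ha using fun j => (hP j).exists_coeff
  -- Column `j` holds the coefficients of `P j` in the powers of `D`, so monicity makes `T`
  -- unitriangular.
  let T : Matrix (Fin n) (Fin n) R := Matrix.of fun l j : Fin n =>
    if l = j then 1 else if (l : ℕ) < j then a j l else 0
  have hT : T.det = 1 := by
    rw [Matrix.det_of_isUpperTriangular]
    · simp [T]
    · intro i j hij
      have h : j < i := hij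
      simp [T, h.ne', h.not_gt]
  have hM : (Matrix.of fun i j : Fin n => P j (f i)) =
      (Matrix.of fun i j : Fin n => (D ^ (j : ℕ)) (f i)) * T := by
    ext i j
    rw [Matrix.mul_apply]
    simp only [T, Matrix.of_apply, Fin.ext_iff]
    rw [Fin.sum_univ_eq_sum_range
      (fun l => (D ^ l) (f i) * if l = (j : ℕ) then 1 else if l < (j : ℕ) then a j l else 0) n,
      ← Finset.sum_subset (s₁ := Finset.range (j + 1))
        (fun l hl => Finset.mem_range.2 ((Finset.mem_range.1 hl).trans_le j.2)),
      Finset.sum_range_succ, ha, add_comm]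
    · congr 1
      · refine Finset.sum_congr rfl fun l hl => ?_
        have := Finset.mem_range.1 hl
        rw [if_neg this.ne, if_pos this, mul_comm]
      · simp
    · intro l _ hl
      have := Finset.mem_range.not.1 hl
      rw [if_neg (by omega), if_neg (by omega), mul_zero]
  rw [hM, Matrix.det_mul, hT, mul_one, ringWr]

/-- If `w = v D^n(uy)`, the Leibniz rule gives `v D^{n+1}(uy) = Dw + (v Du) w`, and the second term
has lower order. -/
theorem isMonicOp_conj (hD : ∀ a b, D (a * b) = a * D b + b * D a) {u v : R} (huv : v * u = 1)
    (n : ℕ) : IsMonicOp D n fun y => v * (D ^ n) (u * y) := by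
  induction n with
  | zero =>
    convert isMonicOp_pow (D := D) 0 using 1
    funext y
    simp [← mul_assoc, huv]
  | succ n ih =>
    have h₁ := (ih.deriv_comp hD).add_mem
      ((lowOps D (n + 1)).smul_mem (v * D u) (ih.mem_lowOps n.lt_succ_self))
    convert h₁ using 1
    funext y
    have h₂ : (D ^ n) (u * y) = u * (v * (D ^ n) (u * y)) := by
      rw [← mul_assoc, mul_comm u v, huv, one_mul]
    simp only [pow_succ', Module.End.mul_apply, Pi.add_apply, Pi.smul_apply, smul_eq_mul]
    conv_lhs => rw [h₂, hD, mul_add, ← mul_assoc, huv, one_mul]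
    ring

/-- Computing the Wronskian of `f` with the conjugates `v D^j u` leaves just one factor `u` to
extract from each of the `n` rows. -/
theorem ringWr_mul (hD : ∀ a b, D (a * b) = a * D b + b * D a) {n : ℕ} {u : R} (hu : IsUnit u)
    (f : Fin n → R) : ringWr D (fun i => u * f i) = u ^ n * ringWr D f := by
  obtain ⟨v, huv⟩ := hu.exists_left_inv
  rw [← det_monicOps _ (isMonicOp_conj hD huv) f, ringWr]
  have : u ^ n = u ^ Fintype.card (Fin n) := by simp
  rw [this, ← Matrix.det_smul]
  congr 1
  ext i j
  simp [← mul_assoc, mul_comm u v, huv]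

theorem ringWr_smul {n : ℕ} (c : Fin n → k) (f : Fin n → R) :
    ringWr D (fun i => c i • f i) = (∏ i, c i) • ringWr D f := by
  rw [ringWr, ringWr, Algebra.smul_def, map_prod, ← Matrix.det_mul_column]
  congr 1
  ext i j
  simp only [Matrix.of_apply, map_smul]
  rw [Algebra.smul_def]

theorem ringWr_eq_zero_of_eq {n : ℕ} (f : Fin n → R) {i j : Fin n} (hij : i ≠ j)
    (h : f i = f j) : ringWr D f = 0 :=
  Matrix.det_zero_of_row_eq hij (by funext l; simp [h])

/-! ### Wronskian operators and Crum's formula -/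

variable (D) in
/-- The operator `y ↦ Wr[f_1, …, f_n, y] / Wr[f_1, …, f_n]`. -/
def ringWrOp {n : ℕ} (f : Fin n → R) (y : R) : R :=
  Ring.inverse (ringWr D f) * ringWr D (Fin.snoc f y : Fin (n + 1) → R)

theorem ringWrOp_self {n : ℕ} (f : Fin n → R) (i : Fin n) : ringWrOp D f (f i) = 0 := by
  rw [ringWrOp, ringWr_eq_zero_of_eq _ (Fin.castSucc_lt_last i).ne (by simp), mul_zero]

/-- Expanding along the row of `y`, the cofactor of `D^n y` is the Wronskian of `f`, which the
denominator cancels. -/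
theorem isMonicOp_ringWrOp {n : ℕ} {f : Fin n → R} (hf : IsUnit (ringWr D f)) :
    IsMonicOp D n (ringWrOp D f) := by
  have key : ∃ c : Fin n → R, ∀ y, ringWr D (Fin.snoc f y : Fin (n + 1) → R) =
      ringWr D f * (D ^ n) y + ∑ j : Fin n, c j * (D ^ (j : ℕ)) y := by
    refine ⟨fun j => (-1) ^ (n + (j : ℕ)) *
      (Matrix.of fun i l : Fin n => (D ^ ((j.castSucc.succAbove l : Fin (n + 1)) : ℕ)) (f i)).det,
      fun y => ?_⟩
    rw [ringWr, Matrix.det_succ_row _ (Fin.last n), Fin.sum_univ_castSucc, add_comm]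
    congr 1
    · simp only [Fin.val_last, Matrix.of_apply, Fin.snoc_last, ← two_mul, pow_mul]
      rw [ringWr, mul_comm]
      simp only [even_two, Even.neg_pow, one_pow, one_mul]
      congr 2
      ext i j
      simp
    · refine Finset.sum_congr rfl fun j _ => ?_
      simp only [Fin.val_last, Fin.val_castSucc, Matrix.of_apply, Fin.snoc_last]
      rw [mul_right_comm]
      congr 3
      ext i l
      simp
  obtain ⟨c, hc⟩ := key
  unfold IsMonicOp
  have : ringWrOp D f - ⇑(D ^ n) =
      ∑ j : Fin n, (Ring.inverse (ringWr D f) * c j) • (⇑(D ^ (j : ℕ)) : R → R) := by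
    funext y
    simp only [Pi.sub_apply, ringWrOp, hc, mul_add, ← mul_assoc, Ring.inverse_mul_cancel _ hf,
      one_mul, add_sub_cancel_left, Finset.mul_sum, Finset.sum_apply, Pi.smul_apply, smul_eq_mul]
  rw [this]
  exact Submodule.sum_mem _ fun j _ => Submodule.smul_mem _ _ (pow_mem_lowOps j.2)

/-- A monic operator of order `n` is determined by `n` elements of its kernel whose Wronskian
is invertible. -/
theorem IsMonicOp.eq_ringWrOp {n : ℕ} {f : Fin n → R} (hf : IsUnit (ringWr D f)) {P : R → R}
    (hP : IsMonicOp D n P) (h : ∀ i, P (f i) = 0) : P = ringWrOp D f := by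
  funext y
  -- With `P` in place of `D^n`, the last column vanishes except for the entry `P y`.
  have h₁ := det_monicOps (D := D) (fun j => if j = n then P else ⇑(D ^ j))
    (fun j => by
      by_cases hj : j = n
      · subst hj
        simpa using hP
      · simpa [hj] using isMonicOp_pow j)
    (Fin.snoc f y : Fin (n + 1) → R)
  have h₂ : ringWr D (Fin.snoc f y : Fin (n + 1) → R) = ringWr D f * P y := by
    rw [← h₁, Matrix.det_succ_column _ (Fin.last n), Fin.sum_univ_castSucc,
      Finset.sum_eq_zero, zero_add]
    · simp only [Fin.val_last, Matrix.of_apply, Fin.snoc_last, ← two_mul, pow_mul]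
      rw [ringWr, mul_comm]
      simp only [even_two, Even.neg_pow, one_pow, one_mul, if_true]
      congr 2
      ext i j
      simp [j.2.ne]
    · intro i _
      simp [h]
  rw [ringWrOp, h₂, ← mul_assoc, Ring.inverse_mul_cancel _ hf, one_mul]

/-- Crum's formula. Beyond column `m` the powers of `D` are replaced by `D^{j-m}` after the operator
of `f`. That operator annihilates every `f i`, so the matrix becomes block lower triangular. -/
theorem ringWr_append (hD : ∀ a b, D (a * b) = a * D b + b * D a) {m n : ℕ} {f : Fin m → R}
    (hf : IsUnit (ringWr D f)) (g : Fin n → R) :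
    ringWr D (Fin.append f g) = ringWr D f * ringWr D (fun i => ringWrOp D f (g i)) := by
  have h := det_monicOps (D := D)
    (fun j => if j < m then ⇑(D ^ j) else fun y => (D ^ (j - m)) (ringWrOp D f y))
    (fun j => by
      by_cases hj : j < m
      · simp [hj, isMonicOp_pow]
      · have := (isMonicOp_ringWrOp hf).pow_comp hD (j - m)
        rw [Nat.sub_add_cancel (not_lt.1 hj)] at this
        simpa [hj] using this) (Fin.append f g)
  rw [← h, ← Matrix.det_submatrix_equiv_self (finSumFinEquiv (m := m) (n := n)), ringWr, ringWr,
    ← Matrix.det_fromBlocks_zero₁₂ _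
      (Matrix.of fun (i : Fin n) (j : Fin m) => (D ^ (j : ℕ)) (g i))]
  congr 1
  ext i j
  rcases i with i | i <;> rcases j with j | j <;> simp [ringWrOp_self]

end DiffOps

/-! ### Smooth functions -/

section Smooth

variable {𝕜 : Type*} [RCLike 𝕜] {U : TopologicalSpace.Opens ℝ}

theorem Dx_mul (f g : Smooth 𝕜 U) : Dx 𝕜 U (f * g) = f * Dx 𝕜 U g + g * Dx 𝕜 U f := by
  ext x
  have h : ext0 ((f * g : Smooth 𝕜 U) : U → 𝕜) =ᶠ[nhds (x : ℝ)]
      ext0 (f : U → 𝕜) * ext0 (g : U → 𝕜) :=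
    Smooth.eventually_eq (fun y => by simp [ext0_apply]) x
  change deriv (ext0 ((f * g : Smooth 𝕜 U) : U → 𝕜)) x =
    (f : U → 𝕜) x * deriv (ext0 (g : U → 𝕜)) x + (g : U → 𝕜) x * deriv (ext0 (f : U → 𝕜)) x
  rw [h.deriv_eq, deriv_mul (Smooth.differentiableAt f x) (Smooth.differentiableAt g x),
    ext0_apply, ext0_apply]
  ring

theorem Smooth.isUnit_of_ne_zero (f : Smooth 𝕜 U) (hf : ∀ x, (f : U → 𝕜) x ≠ 0) : IsUnit f := by
  refine IsUnit.of_mul_eq_one ⟨fun x => ((f : U → 𝕜) x)⁻¹, ?_⟩ ?_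
  · have h : ContDiffOn ℝ ∞ (fun x => (ext0 (f : U → 𝕜) x)⁻¹) U :=
      ContDiffOn.inv f.2 fun x hx => by
        have := hf ⟨x, hx⟩
        rwa [← ext0_apply (f : U → 𝕜)] at this
    exact h.congr (ext0_eqOn fun x => by rw [ext0_apply])
  · ext x
    exact mul_inv_cancel₀ (hf x)

variable (𝕜 U) in
/-- The restriction to `U` of a smooth real function on the line. -/
def Smooth.ofReal (f : ℝ → ℝ) (hf : ContDiff ℝ ∞ f) : Smooth 𝕜 U :=
  ⟨fun x => (f x : 𝕜),
    ((RCLike.ofRealCLM (K := 𝕜)).contDiff.comp_contDiffOn hf.contDiffOn).congr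
      (ext0_eqOn fun _ => rfl)⟩

theorem Smooth.ofReal_apply (f : ℝ → ℝ) (hf : ContDiff ℝ ∞ f) (x : U) :
    (Smooth.ofReal 𝕜 U f hf : U → 𝕜) x = (f x : 𝕜) := rfl

theorem Dx_ofReal (f : ℝ → ℝ) (hf : ContDiff ℝ ∞ f) (hf' : ContDiff ℝ ∞ (deriv f)) :
    Dx 𝕜 U (Smooth.ofReal 𝕜 U f hf) = Smooth.ofReal 𝕜 U (deriv f) hf' := by
  ext x
  have h : ext0 (Smooth.ofReal 𝕜 U f hf : U → 𝕜) =ᶠ[nhds (x : ℝ)] fun y => (f y : 𝕜) :=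
    Smooth.eventually_eq (g := fun y => (f y : 𝕜)) (fun y => rfl) x
  have h₂ : HasDerivAt f (deriv f x) x := (hf.differentiable (by simp) x).hasDerivAt
  have h₃ := (RCLike.ofRealCLM (K := 𝕜)).hasFDerivAt.comp_hasDerivAt (x : ℝ) h₂
  exact h.deriv_eq.trans h₃.deriv

theorem Dx_pow_ofReal (j : ℕ) (f : ℝ → ℝ) (hf : ContDiff ℝ ∞ f) :
    (Dx 𝕜 U ^ j) (Smooth.ofReal 𝕜 U f hf) =
      Smooth.ofReal 𝕜 U (iteratedDeriv j f) (contDiff_iteratedDeriv hf j) := by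
  induction j with
  | zero => simp
  | succ j ih =>
    rw [pow_succ', Module.End.mul_apply, ih, Dx_ofReal _ _ (by
      rw [← iteratedDeriv_succ]; exact contDiff_iteratedDeriv hf _)]
    simp only [iteratedDeriv_succ]

variable (𝕜 U) in
theorem ringWr_ofReal {n : ℕ} (f : Fin n → ℝ → ℝ) (hf : ∀ i, ContDiff ℝ ∞ (f i)) :
    ringWr (Dx 𝕜 U) (fun i => Smooth.ofReal 𝕜 U (f i) (hf i)) =
      Smooth.ofReal 𝕜 U (wronskian f) (contDiff_wronskian hf) := by
  ext x
  let φ : Smooth 𝕜 U →+* 𝕜 := (Pi.evalRingHom _ x).comp (Smooth 𝕜 U).val.toRingHom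
  have h₁ : ∀ g : Smooth 𝕜 U, (g : U → 𝕜) x = φ g := fun g => rfl
  have h₂ : ∀ r : ℝ, (r : 𝕜) = algebraMap ℝ 𝕜 r := fun r => rfl
  rw [Smooth.ofReal_apply, h₁, h₂, ringWr, wronskian, RingHom.map_det, RingHom.map_det]
  congr 1
  ext i j
  simp only [RingHom.mapMatrix_apply, Matrix.map_apply, Matrix.of_apply, Dx_pow_ofReal]
  rfl

end Smooth

/-! ### Wronskians of real functions -/

theorem wronskian_const_mul {n : ℕ} (c : Fin n → ℝ) (f : Fin n → ℝ → ℝ) (x : ℝ) :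
    wronskian (fun i y => c i * f i y) x = (∏ i, c i) * wronskian f x := by
  rw [wronskian, wronskian, ← Matrix.det_mul_column]
  congr 1
  ext i j
  simp [iteratedDeriv_const_mul_field]

theorem wronskian_mul {n : ℕ} (u : ℝ → ℝ) (hu : ContDiff ℝ ∞ u) (hu0 : ∀ x, u x ≠ 0)
    (f : Fin n → ℝ → ℝ) (hf : ∀ i, ContDiff ℝ ∞ (f i)) (x : ℝ) :
    wronskian (fun i y => u y * f i y) x = u x ^ n * wronskian f x := by
  have hu' : IsUnit (Smooth.ofReal ℝ ⊤ u hu) := Smooth.isUnit_of_ne_zero _ fun x => hu0 x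
  have h := ringWr_mul Dx_mul hu' fun i => Smooth.ofReal ℝ ⊤ (f i) (hf i)
  have h₂ := ringWr_ofReal ℝ ⊤ (fun i y => u y * f i y) (fun i => hu.mul (hf i))
  rw [ringWr_ofReal] at h
  have h₃ := congrArg (fun g : Smooth ℝ ⊤ => (g : (⊤ : TopologicalSpace.Opens ℝ) → ℝ) ⟨x, trivial⟩)
    (h₂.symm.trans h)
  exact h₃

/-- Row `p` is `(1, 0, …, 0)`, so Laplace expansion removes it together with the undifferentiated
column. This reduction drives translation invariance. -/
theorem wronskian_of_eq_one {n : ℕ} (f : Fin (n + 1) → ℝ → ℝ) (p : Fin (n + 1))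
    (hp : f p = fun _ => 1) (x : ℝ) :
    wronskian f x = (-1) ^ (p : ℕ) * wronskian (fun i => deriv (f (p.succAbove i))) x := by
  rw [wronskian, Matrix.det_succ_row _ p, Fin.sum_univ_succ, Finset.sum_eq_zero, add_zero]
  · simp only [Matrix.of_apply, hp, Fin.val_zero, add_zero, iteratedDeriv_zero, mul_one]
    rw [wronskian]
    congr 2
    ext i j
    simp [iteratedDeriv_succ']
  · intro j _
    simp [hp, iteratedDeriv_const]

theorem wronskian_perm {n : ℕ} (f : Fin n → ℝ → ℝ) (σ : Equiv.Perm (Fin n)) (x : ℝ) :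
    wronskian (fun i => f (σ i)) x = (Equiv.Perm.sign σ : ℤ) * wronskian f x := by
  rw [wronskian, wronskian, ← Matrix.det_permute]
  rfl

/-! ### Hermite polynomials -/

theorem hermiteH_zero : hermiteH 0 = fun _ => 1 := by
  funext x
  simp [hermiteH, ← Real.exp_add]

theorem hermiteConj_zero : hermiteConj 0 = fun _ => 1 := by
  funext x
  simp [hermiteConj, ← Real.exp_add]

theorem exp_neg_sq_mul_hermiteH (n : ℕ) : (fun x => Real.exp (-x ^ 2) * hermiteH n x) =
    fun x => (-1) ^ n * iteratedDeriv n (fun t : ℝ => Real.exp (-t ^ 2)) x := by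
  funext x
  have : Real.exp (-x ^ 2) * Real.exp (x ^ 2) = 1 := by simp [← Real.exp_add]
  rw [hermiteH]
  linear_combination ((-1) ^ n * iteratedDeriv n (fun t : ℝ => Real.exp (-t ^ 2)) x) * this

theorem exp_sq_mul_hermiteConj (n : ℕ) : (fun x => Real.exp (x ^ 2) * hermiteConj n x) =
    iteratedDeriv n (fun t : ℝ => Real.exp (t ^ 2)) := by
  funext x
  have : Real.exp (x ^ 2) * Real.exp (-x ^ 2) = 1 := by simp [← Real.exp_add]
  rw [hermiteConj, ← mul_assoc, this, one_mul]

theorem deriv_exp_neg_sq_mul_hermiteH (n : ℕ) :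
    deriv (fun x => Real.exp (-x ^ 2) * hermiteH n x) =
      fun x => -(Real.exp (-x ^ 2) * hermiteH (n + 1) x) := by
  rw [exp_neg_sq_mul_hermiteH]
  funext x
  have h := congrFun (exp_neg_sq_mul_hermiteH (n + 1)) x
  rw [h, deriv_const_mul_field', iteratedDeriv_succ, pow_succ]
  ring

theorem deriv_exp_sq_mul_hermiteConj (n : ℕ) :
    deriv (fun x => Real.exp (x ^ 2) * hermiteConj n x) =
      fun x => Real.exp (x ^ 2) * hermiteConj (n + 1) x := by
  rw [exp_sq_mul_hermiteConj, exp_sq_mul_hermiteConj, iteratedDeriv_succ]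

theorem differentiable_hermiteH (n : ℕ) : Differentiable ℝ (hermiteH n) :=
  (contDiff_hermiteH n).differentiable (by simp)

theorem differentiable_hermiteConj (n : ℕ) : Differentiable ℝ (hermiteConj n) :=
  (contDiff_hermiteConj n).differentiable (by simp)

theorem hasDerivAt_hermiteH_succ' (n : ℕ) (x : ℝ) :
    HasDerivAt (hermiteH n) (2 * x * hermiteH n x - hermiteH (n + 1) x) x := by
  have h₁ := (differentiable_hermiteH n x).hasDerivAt
  have h₂ : HasDerivAt (fun x : ℝ => Real.exp (-x ^ 2)) (Real.exp (-x ^ 2) * -(2 * x)) x := by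
    simpa using ((hasDerivAt_pow 2 x).neg).exp
  have h₃ := (h₂.mul h₁).deriv
  have h₄ := congrFun (deriv_exp_neg_sq_mul_hermiteH n) x
  have h₅ := h₃.symm.trans h₄
  have h₆ := Real.exp_pos (-x ^ 2)
  have h₇ : deriv (hermiteH n) x = 2 * x * hermiteH n x - hermiteH (n + 1) x := by
    apply mul_left_cancel₀ h₆.ne'
    linear_combination h₅
  rwa [h₇] at h₁

theorem hasDerivAt_hermiteConj_succ' (n : ℕ) (x : ℝ) :
    HasDerivAt (hermiteConj n) (hermiteConj (n + 1) x - 2 * x * hermiteConj n x) x := by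
  have h₁ := (differentiable_hermiteConj n x).hasDerivAt
  have h₂ : HasDerivAt (fun x : ℝ => Real.exp (x ^ 2)) (Real.exp (x ^ 2) * (2 * x)) x := by
    simpa using (hasDerivAt_pow 2 x).exp
  have h₃ := (h₂.mul h₁).deriv
  have h₄ := congrFun (deriv_exp_sq_mul_hermiteConj n) x
  have h₅ := h₃.symm.trans h₄
  have h₆ := Real.exp_pos (x ^ 2)
  have h₇ : deriv (hermiteConj n) x = hermiteConj (n + 1) x - 2 * x * hermiteConj n x := by
    apply mul_left_cancel₀ h₆.ne'
    linear_combination h₅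
  rwa [h₇] at h₁

/-- Comparing the inductive formula for the derivative with `hasDerivAt_hermiteH_succ'` yields the
three-term recurrence; differentiating that recurrence gives the next case. -/
theorem deriv_hermiteH_succ (n : ℕ) :
    deriv (hermiteH (n + 1)) = fun x => 2 * (n + 1) * hermiteH n x := by
  have key : ∀ x, HasDerivAt (hermiteH (n + 1)) (2 * (n + 1) * hermiteH n x) x := by
    induction n with
    | zero =>
      have h : hermiteH 1 = fun x => 2 * x := by
        funext x
        have h₁ := hasDerivAt_hermiteH_succ' 0 x
        simp only [hermiteH_zero] at h₁
        have := h₁.unique (hasDerivAt_const x (1 : ℝ))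
        simp only [zero_add, mul_one] at this
        linarith
      intro x
      simpa [h, hermiteH_zero] using (hasDerivAt_id x).const_mul 2
    | succ n ih =>
      have h : hermiteH (n + 1 + 1) =
          fun x => 2 * x * hermiteH (n + 1) x - 2 * (n + 1) * hermiteH n x := by
        funext x
        have := (hasDerivAt_hermiteH_succ' (n + 1) x).unique (ih x)
        linarith
      intro x
      have h₂ := (((hasDerivAt_id x).const_mul 2).mul (ih x)).sub
        ((hasDerivAt_hermiteH_succ' n x).const_mul (2 * (n + 1) : ℝ))
      rw [h]
      refine h₂.congr_deriv ?_
      push_cast [id]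
      ring
  exact funext fun x => (key x).deriv

theorem deriv_hermiteConj_succ (n : ℕ) :
    deriv (hermiteConj (n + 1)) = fun x => 2 * (n + 1) * hermiteConj n x := by
  have key : ∀ x, HasDerivAt (hermiteConj (n + 1)) (2 * (n + 1) * hermiteConj n x) x := by
    induction n with
    | zero =>
      have h : hermiteConj 1 = fun x => 2 * x := by
        funext x
        have h₁ := hasDerivAt_hermiteConj_succ' 0 x
        simp only [hermiteConj_zero] at h₁
        have := h₁.unique (hasDerivAt_const x (1 : ℝ))
        simp only [zero_add, mul_one] at this
        linarith
      intro x
      simpa [h, hermiteConj_zero] using (hasDerivAt_id x).const_mul 2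
    | succ n ih =>
      have h : hermiteConj (n + 1 + 1) =
          fun x => 2 * x * hermiteConj (n + 1) x + 2 * (n + 1) * hermiteConj n x := by
        funext x
        have := (hasDerivAt_hermiteConj_succ' (n + 1) x).unique (ih x)
        linarith
      intro x
      have h₂ := (((hasDerivAt_id x).const_mul 2).mul (ih x)).add
        ((hasDerivAt_hermiteConj_succ' n x).const_mul (2 * (n + 1) : ℝ))
      rw [h]
      refine h₂.congr_deriv ?_
      push_cast [id]
      ring
  exact funext fun x => (key x).deriv

theorem hermiteH_add_two (n : ℕ) (x : ℝ) :
    hermiteH (n + 2) x = 2 * x * hermiteH (n + 1) x - 2 * (n + 1) * hermiteH n x := by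
  have h₁ := (hasDerivAt_hermiteH_succ' (n + 1) x).deriv
  rw [deriv_hermiteH_succ] at h₁
  simp only at h₁
  linarith

/-! ### Translation invariance of the normalized pseudo-Wronskians -/

/-- The functions `e^{x²} H̃_{-s_i-1}` followed by the `H_{t_j}`. -/
def hermiteSeed {p r : ℕ} (s : Fin p → ℤ) (t : Fin r → ℤ) : Fin (p + r) → ℝ → ℝ :=
  Fin.append (fun i x => Real.exp (x ^ 2) * hermiteConj (-s i - 1).toNat x)
    (fun j x => hermiteH (t j).toNat x)

/-- The normalized pseudo-Wronskian of two finite sequences of labels. -/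
def normalizedWr {p r : ℕ} (s : Fin p → ℤ) (t : Fin r → ℤ) (x : ℝ) : ℝ :=
  (-1) ^ (p * r) * (Real.exp (-(p : ℝ) * x ^ 2) * wronskian (hermiteSeed s t) x) /
    ((∏ i, ∏ j ∈ Finset.Ioi i, 2 * ((s i : ℝ) - (s j : ℝ))) *
      (∏ i, ∏ j ∈ Finset.Ioi i, 2 * ((t j : ℝ) - (t i : ℝ))))

theorem contDiff_hermiteSeed {p r : ℕ} (s : Fin p → ℤ) (t : Fin r → ℤ) (i : Fin (p + r)) :
    ContDiff ℝ ∞ (hermiteSeed s t i) := by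
  refine Fin.addCases (fun i => ?_) (fun j => ?_) i
  · have := contDiff_hermiteConj (-s i - 1).toNat
    simp only [hermiteSeed, Fin.append_left]
    fun_prop
  · simp only [hermiteSeed, Fin.append_right]
    exact contDiff_hermiteH _

theorem wronskian_of_eq_one_of_eq {n N : ℕ} (h : n + 1 = N) (f : Fin N → ℝ → ℝ) (p : Fin (n + 1))
    (hp : f (Fin.cast h p) = fun _ => 1) (x : ℝ) :
    wronskian f x =
      (-1) ^ (p : ℕ) * wronskian (fun i => deriv (f (Fin.cast h (p.succAbove i)))) x := by
  subst h
  exact wronskian_of_eq_one f p hp x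

/-- The new label contributes `H_0 = 1`. Removing its row differentiates the others: each `e^{x²}
H̃_k` is raised and each `H_{t+1}` becomes `2(t+1) H_t`. These factors match the new Vandermonde
factors, and the sign `(-1)^p` from the row position matches the change from `(-1)^{pr}` to
`(-1)^{p(r+1)}`. -/
theorem normalizedWr_cons_zero {p r : ℕ} (s : Fin p → ℤ) (t : Fin r → ℤ) (hs : ∀ i, s i < -1)
    (ht : ∀ j, 0 ≤ t j) (x : ℝ) :
    normalizedWr (fun i => s i + 1) (Fin.cons 0 fun j => t j + 1 : Fin (r + 1) → ℤ) x =
      normalizedWr s t x := by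
  have hw : wronskian (hermiteSeed (fun i => s i + 1)
      (Fin.cons 0 fun j => t j + 1 : Fin (r + 1) → ℤ)) x =
      (-1) ^ p * ((∏ j, 2 * ((t j : ℝ) + 1)) * wronskian (hermiteSeed s t) x) := by
    rw [wronskian_of_eq_one_of_eq (n := p + r) rfl _ (Fin.natAdd p (0 : Fin (r + 1)))]
    · congr 1
      have hc : ∏ j, 2 * ((t j : ℝ) + 1) =
          ∏ i, (Fin.append (fun _ : Fin p => (1 : ℝ)) fun j => 2 * ((t j : ℝ) + 1)) i := by
        rw [Fin.prod_univ_add]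
        simp
      rw [hc, ← wronskian_const_mul]
      congr 1
      funext i
      refine Fin.addCases (fun i => ?_) (fun j => ?_) i
      · have h₁ : Fin.cast rfl ((Fin.natAdd p (0 : Fin (r + 1)) : Fin (p + r + 1)).succAbove
            (Fin.castAdd r i)) = Fin.castAdd (r + 1) i := by
          ext
          simp [Fin.succAbove, Fin.lt_def]
        rw [h₁]
        simp only [hermiteSeed, Fin.append_left, one_mul]
        rw [deriv_exp_sq_mul_hermiteConj]
        have : (-(s i + 1) - 1).toNat + 1 = (-s i - 1).toNat := by have := hs i; omega
        rw [this]
      · have h₁ : Fin.cast rfl ((Fin.natAdd p (0 : Fin (r + 1)) : Fin (p + r + 1)).succAbove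
            (Fin.natAdd p j)) = Fin.natAdd p j.succ := by
          ext
          simp [Fin.succAbove, Fin.lt_def, add_assoc]
        rw [h₁]
        simp only [hermiteSeed, Fin.append_right, Fin.cons_succ]
        have h₂ : (t j + 1).toNat = (t j).toNat + 1 := by have := ht j; omega
        have h₃ : (((t j).toNat : ℕ) : ℝ) = t j := by
          exact_mod_cast Int.toNat_of_nonneg (ht j)
        rw [h₂, deriv_hermiteH_succ, h₃]
    · simp [hermiteSeed, hermiteH_zero]
  have hn : ∏ j, ((t j : ℝ) + 1) ≠ 0 := Finset.prod_ne_zero_iff.2 fun j _ => by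
    have : (0 : ℝ) ≤ t j := by exact_mod_cast ht j
    positivity
  simp only [normalizedWr, hw]
  rw [Fin.prod_univ_succ (n := r)]
  simp only [Fin.prod_Ioi_zero, Fin.prod_Ioi_succ, Fin.cons_zero, Fin.cons_succ, Int.cast_zero,
    Int.cast_add, Int.cast_one, sub_zero, add_sub_add_right_eq_sub]
  rw [Nat.mul_succ, pow_add]
  have hsq : ((-1 : ℝ) ^ p) * (-1) ^ p = 1 := by rw [← mul_pow]; simp
  have hn' : ∏ j, 2 * ((t j : ℝ) + 1) ≠ 0 := by
    rw [Finset.prod_mul_distrib]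
    exact mul_ne_zero (by simp) hn
  generalize (∏ j, 2 * ((t j : ℝ) + 1)) = c at hn' ⊢
  symm
  rw [← mul_div_mul_left _ _ hn']
  congr 1
  · linear_combination -(c * (-1) ^ (p * r) * Real.exp (-(p : ℝ) * x ^ 2) *
      wronskian (hermiteSeed s t) x) * hsq
  · ring

/-- The new label contributes `e^{x²}`, which becomes `1` once every function is multiplied by
`e^{-x²}`. Differentiation then lowers the `H̃`, with factors `2(-s_i)`, and raises the `H`, with
total sign `(-1)^r`. One surplus power of `e^{x²}` is absorbed by the prefactor. -/
theorem normalizedWr_cons_neg_one {p r : ℕ} (s : Fin p → ℤ) (t : Fin r → ℤ) (hs : ∀ i, s i < 0)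
    (ht : ∀ j, 0 < t j) (x : ℝ) :
    normalizedWr (Fin.cons (-1) fun i => s i - 1 : Fin (p + 1) → ℤ) (fun j => t j - 1) x =
      normalizedWr s t x := by
  have hexp : ∀ y : ℝ, Real.exp (y ^ 2) * Real.exp (-y ^ 2) = 1 := fun y => by
    simp [← Real.exp_add]
  let G : Fin (p + 1 + r) → ℝ → ℝ := fun i y => Real.exp (-y ^ 2) *
    hermiteSeed (Fin.cons (-1) fun i => s i - 1 : Fin (p + 1) → ℤ) (fun j => t j - 1) i y
  have hG : ∀ i, ContDiff ℝ ∞ (G i) := fun i => by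
    have := contDiff_hermiteSeed (Fin.cons (-1) fun i => s i - 1 : Fin (p + 1) → ℤ)
      (fun j => t j - 1) i
    fun_prop
  have hGl : ∀ i, G (Fin.castAdd r i) = hermiteConj
      (-(Fin.cons (-1) fun i => s i - 1 : Fin (p + 1) → ℤ) i - 1).toNat := fun i => by
    funext y
    simp only [G, hermiteSeed, Fin.append_left]
    rw [← mul_assoc, mul_comm (Real.exp _), hexp, one_mul]
  have hw₁ : wronskian G x = wronskian (fun i y => (Fin.append (fun i : Fin p => 2 * (-(s i : ℝ)))
      fun j : Fin r => (-1 : ℝ)) i * (Real.exp (-y ^ 2) * hermiteSeed s t i y)) x := by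
    rw [wronskian_of_eq_one_of_eq (n := p + r) (by omega) G 0, Fin.val_zero, pow_zero, one_mul]
    · congr 1
      funext i
      refine Fin.addCases (fun i => ?_) (fun j => ?_) i
      · have h₁ : Fin.cast (by omega) ((0 : Fin (p + r + 1)).succAbove (Fin.castAdd r i)) =
            Fin.castAdd r i.succ := by
          ext
          simp
        rw [h₁, hGl]
        have h₂ : (-(s i - 1) - 1).toNat = (-s i - 1).toNat + 1 := by have := hs i; omega
        have h₃ : (((-s i - 1).toNat : ℕ) : ℝ) = -s i - 1 := by
          have := Int.toNat_of_nonneg (show 0 ≤ -s i - 1 by have := hs i; omega)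
          exact_mod_cast this
        rw [Fin.cons_succ, h₂, deriv_hermiteConj_succ, h₃]
        funext y
        simp only [hermiteSeed, Fin.append_left]
        rw [← mul_assoc (Real.exp _), mul_comm (Real.exp _), hexp]
        ring
      · have h₁ : Fin.cast (by omega) ((0 : Fin (p + r + 1)).succAbove (Fin.natAdd p j)) =
            Fin.natAdd (p + 1) j := by
          ext
          simp
          omega
        rw [h₁]
        simp only [G, hermiteSeed, Fin.append_right]
        have h₂ : (t j - 1).toNat + 1 = (t j).toNat := by have := ht j; omega
        rw [deriv_exp_neg_sq_mul_hermiteH, h₂]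
        funext y
        ring
    · have : Fin.cast (by omega) (0 : Fin (p + r + 1)) = Fin.castAdd r (0 : Fin (p + 1)) := by
        ext
        simp
      rw [this, hGl]
      simp [hermiteConj_zero]
  have hw : wronskian (hermiteSeed (Fin.cons (-1) fun i => s i - 1 : Fin (p + 1) → ℤ)
      (fun j => t j - 1)) x = Real.exp (x ^ 2) ^ (p + 1 + r) *
        (((∏ i, 2 * (-(s i : ℝ))) * (-1) ^ r) *
          (Real.exp (-x ^ 2) ^ (p + r) * wronskian (hermiteSeed s t) x)) := by
    have h₁ := wronskian_mul (fun y => Real.exp (y ^ 2)) (by fun_prop)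
      (fun y => (Real.exp_pos _).ne') G hG x
    have h₂ := wronskian_mul (fun y => Real.exp (-y ^ 2)) (by fun_prop)
      (fun y => (Real.exp_pos _).ne') _ (contDiff_hermiteSeed s t) x
    rw [← h₂]
    rw [hw₁, wronskian_const_mul, Fin.prod_univ_add] at h₁
    simp only [Fin.append_left, Fin.append_right, Finset.prod_const, Finset.card_univ,
      Fintype.card_fin] at h₁
    rw [← h₁]
    congr 1
    funext i y
    simp only [G]
    rw [← mul_assoc, hexp, one_mul]
  have hn : ∏ i, 2 * (-(s i : ℝ)) ≠ 0 := Finset.prod_ne_zero_iff.2 fun i _ => by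
    have : (s i : ℝ) < 0 := by exact_mod_cast hs i
    have : (s i : ℝ) ≠ 0 := this.ne
    simpa
  simp only [normalizedWr, hw]
  rw [Fin.prod_univ_succ (n := p)]
  simp only [Fin.prod_Ioi_zero, Fin.prod_Ioi_succ, Fin.cons_zero, Fin.cons_succ,
    Int.cast_sub, Int.cast_one, sub_sub_sub_cancel_right, Int.cast_neg]
  have h₀ : ∀ i, (-1 : ℝ) - (s i - 1) = -s i := fun i => by ring
  simp only [h₀]
  generalize (∏ i, 2 * (-(s i : ℝ))) = c at hn ⊢
  have hsq : ((-1 : ℝ) ^ r) * (-1) ^ r = 1 := by rw [← mul_pow]; simp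
  have he : Real.exp (-((p + 1 : ℕ) : ℝ) * x ^ 2) * Real.exp (x ^ 2) ^ (p + 1 + r) *
      Real.exp (-x ^ 2) ^ (p + r) = Real.exp (-(p : ℝ) * x ^ 2) := by
    rw [← Real.exp_nat_mul, ← Real.exp_nat_mul, ← Real.exp_add, ← Real.exp_add]
    congr 1
    push_cast
    ring
  rw [← he, Nat.succ_mul, pow_add]
  symm
  rw [← mul_div_mul_left _ _ hn]
  congr 1
  · linear_combination -(c * (-1) ^ (p * r) * Real.exp (-((p + 1 : ℕ) : ℝ) * x ^ 2) *
      Real.exp (x ^ 2) ^ (p + 1 + r) * Real.exp (-x ^ 2) ^ (p + r) *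
      wronskian (hermiteSeed s t) x) * hsq
  · ring

/-! ### Translates of Maya diagrams -/

namespace MayaDiagram

theorem ext_carrier {M N : MayaDiagram} (h : ∀ m, m ∈ M.carrier ↔ m ∈ N.carrier) : M = N := by
  cases M
  cases N
  congr
  exact Set.ext h

/-- The translate `M + n`. -/
def shift (M : MayaDiagram) (n : ℤ) : MayaDiagram :=
  have h := M.finite_of_symmDiff _ (M.finite_shift_symmDiff n)
  ⟨{m : ℤ | m - n ∈ M.carrier}, h.1, h.2⟩

theorem mem_shift {M : MayaDiagram} {n m : ℤ} : m ∈ (M.shift n).carrier ↔ m - n ∈ M.carrier :=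
  Iff.rfl

theorem mem_kPos {M : MayaDiagram} {m : ℤ} : m ∈ M.KPos ↔ m ∈ M.carrier ∧ 0 ≤ m := by
  simp [KPos]

theorem mem_kNeg {M : MayaDiagram} {m : ℤ} : m ∈ M.KNeg ↔ m ∉ M.carrier ∧ m < 0 := by
  simp [KNeg]

theorem posEnum_strictMono (M : MayaDiagram) : StrictMono M.posEnum :=
  (M.KPos.orderEmbOfFin rfl).strictMono

theorem negEnum_strictAnti (M : MayaDiagram) : StrictAnti M.negEnum :=
  fun _ _ h => (M.KNeg.orderEmbOfFin rfl).strictMono (Fin.rev_lt_rev.2 h)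

theorem range_posEnum (M : MayaDiagram) : Set.range M.posEnum = M.KPos :=
  Finset.range_orderEmbOfFin _ rfl

theorem range_negEnum (M : MayaDiagram) : Set.range M.negEnum = M.KNeg := by
  rw [← Finset.range_orderEmbOfFin M.KNeg rfl]
  exact Fin.revPerm.surjective.range_comp _

theorem posEnum_mem (M : MayaDiagram) (j) : M.posEnum j ∈ M.carrier ∧ 0 ≤ M.posEnum j :=
  mem_kPos.1 (Finset.orderEmbOfFin_mem _ rfl j)

theorem negEnum_mem (M : MayaDiagram) (i) : M.negEnum i ∉ M.carrier ∧ M.negEnum i < 0 :=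
  mem_kNeg.1 (Finset.orderEmbOfFin_mem _ rfl i.rev)

theorem card_eq_of_range_eq {n : ℕ} {f : Fin n → ℤ} (hf : Function.Injective f) {S : Finset ℤ}
    (h : Set.range f = S) : S.card = n := by
  rw [← Set.ncard_coe_finset, ← h, ← Set.image_univ, Set.ncard_image_of_injective _ hf]
  simp

/-- Monotone enumerations of a finite set are unique, so any explicit pair of sequences may be used
to compute `Ĥ_M`. -/
theorem hatH_eq_normalizedWr (M : MayaDiagram) {p r : ℕ} {s : Fin p → ℤ} {t : Fin r → ℤ}
    (hs : StrictAnti s) (ht : StrictMono t) (hs' : Set.range s = M.KNeg)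
    (ht' : Set.range t = M.KPos) : M.hatH = normalizedWr s t := by
  obtain rfl := card_eq_of_range_eq hs.injective hs'
  obtain rfl := card_eq_of_range_eq ht.injective ht'
  obtain rfl : s = M.negEnum := by
    have h := Finset.orderEmbOfFin_unique (s := M.KNeg) rfl (f := fun i => s i.rev)
      (fun i => Finset.mem_coe.1 (hs' ▸ Set.mem_range_self _))
      (fun i j h => hs (Fin.rev_lt_rev.2 h))
    funext i
    have := congrFun h i.rev
    simpa [negEnum] using this
  obtain rfl : t = M.posEnum := Finset.orderEmbOfFin_unique rfl
    (fun i => Finset.mem_coe.1 (ht' ▸ Set.mem_range_self _)) ht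
  rfl

theorem range_cons_eq {n : ℕ} (a : ℤ) (f : Fin n → ℤ) (m : ℤ) :
    m ∈ Set.range (Fin.cons a f : Fin (n + 1) → ℤ) ↔ m = a ∨ m ∈ Set.range f := by
  simp [Fin.range_cons]

theorem strictMono_cons_shift (M : MayaDiagram) :
    StrictMono (Fin.cons 0 fun j => M.posEnum j + 1 : Fin (M.KPos.card + 1) → ℤ) := by
  refine Fin.cases (Fin.cases (by simp) fun j _ => ?_) (fun i => Fin.cases (by simp) fun j h => ?_)
  · have := (M.posEnum_mem j).2
    simp
    omega
  · have := M.posEnum_strictMono (Fin.succ_lt_succ_iff.1 h)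
    simpa

theorem range_cons_shift {M : MayaDiagram} (h : -1 ∈ M.carrier) :
    Set.range (Fin.cons 0 fun j => M.posEnum j + 1 : Fin (M.KPos.card + 1) → ℤ) =
      (M.shift 1).KPos := by
  ext m
  have h₁ : m ∈ Set.range (fun j => M.posEnum j + 1) ↔ m - 1 ∈ Set.range M.posEnum := by
    simp only [Set.mem_range, eq_sub_iff_add_eq]
  rw [range_cons_eq, h₁, range_posEnum, Finset.mem_coe, Finset.mem_coe, mem_kPos, mem_kPos,
    mem_shift]
  by_cases hm : m = 0
  · simpa [hm] using h
  · have : 0 ≤ m - 1 ↔ 0 ≤ m := by omega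
    rw [this, or_iff_right hm]

/-- Translation moves position `-1` to `0`. If it is filled, `K^+` gains the label `0`; if it is
empty, `K^-` loses the label `-1`, and the second reduction is applied from `M + 1` back to `M`. -/
theorem hatH_shift_one (M : MayaDiagram) : (M.shift 1).hatH = M.hatH := by
  by_cases h : -1 ∈ M.carrier
  · rw [hatH_eq_normalizedWr (M.shift 1) (s := fun i => M.negEnum i + 1)
      (fun i j hij => by simpa using M.negEnum_strictAnti hij) M.strictMono_cons_shift ?_
      (range_cons_shift h)]
    · have h₂ : ∀ i, M.negEnum i < -1 := fun i => by
        have h₁ := M.negEnum_mem i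
        have : M.negEnum i ≠ -1 := fun h₃ => h₁.1 (h₃ ▸ h)
        omega
      funext x
      rw [normalizedWr_cons_zero _ _ h₂ fun j => (M.posEnum_mem j).2]
      rfl
    · ext m
      have h₁ : m ∈ Set.range (fun j => M.negEnum j + 1) ↔ m - 1 ∈ Set.range M.negEnum := by
        simp only [Set.mem_range, eq_sub_iff_add_eq]
      rw [h₁, range_negEnum, Finset.mem_coe, Finset.mem_coe, mem_kNeg, mem_kNeg, mem_shift]
      refine and_congr_right fun h₂ => ?_
      have : m - 1 ≠ -1 := fun h₃ => h₂ (h₃ ▸ h)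
      omega
  · let N := M.shift 1
    rw [hatH_eq_normalizedWr M
      (s := (Fin.cons (-1) fun i => N.negEnum i - 1 : Fin (N.KNeg.card + 1) → ℤ))
      (t := fun j => N.posEnum j - 1) ?_
      (fun i j hij => by simpa using N.posEnum_strictMono hij) ?_ ?_]
    · have h₂ : ∀ j, 0 < N.posEnum j := fun i => by
        have h₁ := N.posEnum_mem i
        have : N.posEnum i ≠ 0 := fun h₃ => by
          rw [h₃, mem_shift] at h₁
          exact h h₁.1
        omega
      funext x
      rw [normalizedWr_cons_neg_one _ _ (fun j => (N.negEnum_mem j).2) h₂]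
      rfl
    · refine Fin.cases (Fin.cases (by simp) fun j _ => ?_)
        (fun i => Fin.cases (by simp) fun j h => ?_)
      · have := (N.negEnum_mem j).2
        simp
        omega
      · have := N.negEnum_strictAnti (Fin.succ_lt_succ_iff.1 h)
        simpa
    · ext m
      have h₁ : m ∈ Set.range (fun j => N.negEnum j - 1) ↔ m + 1 ∈ Set.range N.negEnum := by
        simp only [Set.mem_range, sub_eq_iff_eq_add]
      rw [range_cons_eq, h₁, range_negEnum, Finset.mem_coe, Finset.mem_coe, mem_kNeg, mem_kNeg,
        mem_shift, add_sub_cancel_right]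
      by_cases hm : m = -1
      · simpa [hm] using h
      · have : m + 1 < 0 ↔ m < 0 := by omega
        simp [hm, this]
    · ext m
      have h₁ : m ∈ Set.range (fun j => N.posEnum j - 1) ↔ m + 1 ∈ Set.range N.posEnum := by
        simp only [Set.mem_range, sub_eq_iff_eq_add]
      rw [h₁, range_posEnum, Finset.mem_coe, Finset.mem_coe, mem_kPos, mem_kPos, mem_shift,
        add_sub_cancel_right]
      refine and_congr_right fun h₂ => ?_
      have : m ≠ -1 := fun h₃ => h (h₃ ▸ h₂)
      omega

theorem shift_zero (M : MayaDiagram) : M.shift 0 = M :=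
  ext_carrier fun m => by rw [mem_shift, sub_zero]

theorem shift_shift (M : MayaDiagram) (a b : ℤ) : (M.shift a).shift b = M.shift (a + b) :=
  ext_carrier fun m => by rw [mem_shift, mem_shift, mem_shift, sub_sub, add_comm b]

theorem hatH_shift (M : MayaDiagram) (n : ℕ) : (M.shift n).hatH = M.hatH := by
  induction n with
  | zero => rw [Nat.cast_zero, shift_zero]
  | succ n ih => rw [Nat.cast_succ, ← shift_shift, hatH_shift_one, ih]

end MayaDiagram

/-! ### Hermite Wronskians with arbitrary label sequences -/

/-- The Vandermonde product `∏_{i<j} 2 (t_j - t_i)`. -/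
def vdm {r : ℕ} (t : Fin r → ℤ) : ℝ := ∏ i, ∏ j ∈ Finset.Ioi i, 2 * ((t j : ℝ) - (t i : ℝ))

theorem vdm_eq_det {r : ℕ} (t : Fin r → ℤ) :
    vdm t = (Matrix.vandermonde fun i => 2 * (t i : ℝ)).det := by
  rw [Matrix.det_vandermonde, vdm]
  simp only [mul_sub]

theorem vdm_ne_zero {r : ℕ} {t : Fin r → ℤ} (ht : Function.Injective t) : vdm t ≠ 0 := by
  rw [vdm_eq_det, Matrix.det_vandermonde_ne_zero_iff]
  intro i j h
  simpa [ht.eq_iff] using h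

theorem vdm_perm {r : ℕ} (t : Fin r → ℤ) (σ : Equiv.Perm (Fin r)) :
    vdm (fun i => t (σ i)) = (Equiv.Perm.sign σ : ℤ) * vdm t := by
  rw [vdm_eq_det, vdm_eq_det, ← Matrix.det_permute]
  rfl

theorem vdm_add_const {r : ℕ} (t : Fin r → ℤ) (n : ℤ) : vdm (fun i => t i + n) = vdm t := by
  simp [vdm]

/-- The factors gained by one extra label; all constants in the ladder relation come from here. -/
theorem vdm_snoc {r : ℕ} (t : Fin r → ℤ) (m : ℤ) :
    vdm (Fin.snoc t m : Fin (r + 1) → ℤ) = vdm t * ∏ i, 2 * ((m : ℝ) - t i) := by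
  have h : ∀ {n : ℕ} (t : Fin n → ℤ), vdm t =
      ∏ i, ∏ j, if i < j then 2 * ((t j : ℝ) - (t i : ℝ)) else 1 := by
    intro n t
    refine Finset.prod_congr rfl fun i _ => ?_
    rw [← Finset.prod_filter]
    congr 1
    ext j
    simp
  rw [h, h, Fin.prod_univ_castSucc]
  simp only [Fin.prod_univ_castSucc, Fin.snoc_castSucc, Fin.snoc_last, Fin.castSucc_lt_castSucc_iff,
    Fin.castSucc_lt_last, lt_irrefl, if_true, if_false, mul_one, Finset.prod_mul_distrib,
    (Fin.castSucc_lt_last _).not_gt, Finset.prod_const_one]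

/-- The Wronskian of the Hermite polynomials with labels `t_i + n`. -/
def hermiteWr (n : ℕ) {r : ℕ} (t : Fin r → ℤ) : ℝ → ℝ :=
  wronskian fun j => hermiteH (t j + n).toNat

theorem contDiff_hermiteWr (n : ℕ) {r : ℕ} (t : Fin r → ℤ) : ContDiff ℝ ∞ (hermiteWr n t) :=
  contDiff_wronskian fun _ => contDiff_hermiteH _

theorem wronskian_cast {m n : ℕ} (h : m = n) (f : Fin n → ℝ → ℝ) :
    wronskian (fun i : Fin m => f (Fin.cast h i)) = wronskian f := by
  subst h
  rfl

/-! ### Labellings of Maya diagrams -/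

namespace MayaDiagram

/-- Wronskian and Vandermonde product both change by the sign of a permutation, so their quotient
ignores the order of the labels. Hence labels may simply be appended without sorting. -/
theorem hatH_eq_of_neg_subset {M : MayaDiagram} (hM : ∀ m < 0, m ∈ M.carrier) {r : ℕ}
    {t : Fin r → ℤ} (ht : Function.Injective t) (ht' : Set.range t = M.KPos) (x : ℝ) :
    M.hatH x = hermiteWr 0 t x / vdm t := by
  obtain rfl := card_eq_of_range_eq ht ht'
  have h₁ : M.hatH = normalizedWr (Fin.elim0 : Fin 0 → ℤ) M.posEnum :=
    M.hatH_eq_normalizedWr (fun i => i.elim0) M.posEnum_strictMono (by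
      ext m
      simp only [Set.range_eq_empty, Set.mem_empty_iff_false, Finset.mem_coe, mem_kNeg, false_iff]
      exact fun h => h.1 (hM m h.2)) M.range_posEnum
  have h₂ : M.hatH x = hermiteWr 0 M.posEnum x / vdm M.posEnum := by
    have h₃ : wronskian (hermiteSeed (Fin.elim0 : Fin 0 → ℤ) M.posEnum) =
        hermiteWr 0 M.posEnum := by
      rw [hermiteWr, ← wronskian_cast (zero_add _) fun j => hermiteH (M.posEnum j + (0 : ℕ)).toNat]
      congr 1
      funext i
      refine Fin.addCases (fun i => i.elim0) (fun j => ?_) i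
      have h₄ : Fin.cast (zero_add _) (Fin.natAdd 0 j) = j := by
        ext
        simp
      simp only [hermiteSeed, Fin.append_right, Nat.cast_zero, add_zero, h₄]
    rw [h₁, normalizedWr, h₃, vdm]
    simp
  let σ : Equiv.Perm (Fin M.KPos.card) := (Equiv.ofInjective t ht).trans
    ((Equiv.setCongr (ht'.trans M.range_posEnum.symm)).trans
      (Equiv.ofInjective M.posEnum M.posEnum_strictMono.injective).symm)
  have hσ : t = fun i => M.posEnum (σ i) := by
    funext i
    simp [σ, Equiv.apply_ofInjective_symm]
  have h₃ : ((Equiv.Perm.sign σ : ℤ) : ℝ) ≠ 0 := by simp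
  rw [h₂, hσ, vdm_perm, hermiteWr, hermiteWr,
    wronskian_perm (fun i => hermiteH (M.posEnum i + (0 : ℕ)).toNat), mul_div_mul_left _ _ h₃]

/-- The members of `M` that are at least `-n` are enumerated by `t`, and all smaller integers
belong to `M`. -/
structure IsLabelling (M : MayaDiagram) (n : ℕ) {r : ℕ} (t : Fin r → ℤ) : Prop where
  lower : ∀ m : ℤ, m < -n → m ∈ M.carrier
  injective : Function.Injective t
  range_iff : ∀ m, m ∈ Set.range t ↔ m ∈ M.carrier ∧ -(n : ℤ) ≤ m

theorem exists_isLabelling (M : MayaDiagram) :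
    ∃ (n r : ℕ) (t : Fin r → ℤ), M.IsLabelling n t := by
  obtain ⟨b, hb⟩ := M.finite_neg.bddBelow
  -- As `b` bounds the negative holes from below, every integer under `-|b|` belongs to `M`.
  refine ⟨b.natAbs, _, fun j => (M.shift b.natAbs).posEnum j - b.natAbs, fun m hm => ?_, ?_, ?_⟩
  · by_contra h
    have := hb ⟨h, by omega⟩
    omega
  · intro i j h
    exact (posEnum_strictMono _).injective (by simpa using h)
  · intro m
    have h₁ : (m ∈ Set.range fun j => (M.shift b.natAbs).posEnum j - b.natAbs) ↔
        m + b.natAbs ∈ Set.range (M.shift b.natAbs).posEnum := by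
      simp only [Set.mem_range, sub_eq_iff_eq_add]
    rw [h₁, range_posEnum, Finset.mem_coe, mem_kPos, mem_shift, add_sub_cancel_right,
      neg_le_iff_add_nonneg]

theorem IsLabelling.range_shift {M : MayaDiagram} {n r : ℕ} {t : Fin r → ℤ}
    (h : M.IsLabelling n t) : Set.range (fun j => t j + (n : ℤ)) = (M.shift n).KPos := by
  ext m
  have h₁ : (m ∈ Set.range fun j => t j + (n : ℤ)) ↔ m - n ∈ Set.range t := by
    simp only [Set.mem_range, eq_sub_iff_add_eq]
  rw [h₁, h.range_iff, Finset.mem_coe, mem_kPos, mem_shift]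
  refine and_congr_right fun _ => ?_
  omega

theorem IsLabelling.injective_shift {M : MayaDiagram} {n r : ℕ} {t : Fin r → ℤ}
    (h : M.IsLabelling n t) : Function.Injective fun j => t j + (n : ℤ) :=
  fun _ _ hij => h.injective (by simpa using hij)

theorem IsLabelling.hatH_eq {M : MayaDiagram} {n r : ℕ} {t : Fin r → ℤ} (h : M.IsLabelling n t)
    (x : ℝ) : M.hatH x = hermiteWr n t x / vdm t := by
  rw [← M.hatH_shift n, hatH_eq_of_neg_subset (M := M.shift n) (fun m hm => h.lower _ (by omega))
    h.injective_shift h.range_shift, vdm_add_const]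
  simp [hermiteWr]

theorem mem_flip {M : MayaDiagram} {k m : ℤ} (hk : k ∉ M.carrier) :
    m ∈ (M.flip k).carrier ↔ m = k ∨ m ∈ M.carrier := by
  change m ∈ symmDiff M.carrier {k} ↔ _
  rw [Set.mem_symmDiff, Set.mem_singleton_iff]
  by_cases hm : m = k
  · simp [hm, hk]
  · simp [hm]

theorem IsLabelling.flip {M : MayaDiagram} {n r : ℕ} {t : Fin r → ℤ} (h : M.IsLabelling n t)
    {m : ℤ} (hm : m ∉ M.carrier) :
    (M.flip m).IsLabelling n (Fin.snoc t m : Fin (r + 1) → ℤ) where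
  lower k hk := (mem_flip hm).2 (Or.inr (h.lower k hk))
  injective := by
    rw [Fin.snoc_injective_iff]
    exact ⟨h.injective, fun h₁ => hm ((h.range_iff m).1 h₁).1⟩
  range_iff k := by
    have h₁ : -(n : ℤ) ≤ m := by
      by_contra h₂
      exact hm (h.lower m (not_le.1 h₂))
    rw [mem_flip hm, Fin.range_snoc, Set.mem_insert_iff, h.range_iff]
    by_cases hk : k = m
    · simp [hk, h₁]
    · simp [hk]

theorem IsLabelling.hatH_flip_div {M : MayaDiagram} {n r : ℕ} {t : Fin r → ℤ}
    (h : M.IsLabelling n t) {m : ℤ} (hm : m ∉ M.carrier) (x : ℝ) :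
    (M.flip m).hatH x / M.hatH x = (∏ i, 2 * ((m : ℝ) - t i))⁻¹ *
      (hermiteWr n (Fin.snoc t m : Fin (r + 1) → ℤ) x / hermiteWr n t x) := by
  rw [(h.flip hm).hatH_eq, h.hatH_eq, vdm_snoc]
  have := vdm_ne_zero h.injective
  -- In both degenerate cases each side is `0`, by the convention for division by zero.
  by_cases h₁ : hermiteWr n t x = 0
  · simp [h₁]
  · by_cases h₂ : ∏ i, 2 * ((m : ℝ) - t i) = 0
    · simp [h₂]
    · field_simp

theorem card_kPos_shift {M : MayaDiagram} (hM : ∀ m < 0, m ∈ M.carrier) (q : ℕ) :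
    (M.shift q).KPos.card = M.KPos.card + q := by
  induction q with
  | zero => rw [Nat.cast_zero, shift_zero, add_zero]
  | succ q ih =>
    rw [Nat.cast_succ, ← shift_shift, ← add_assoc, ← ih]
    exact card_eq_of_range_eq (strictMono_cons_shift _).injective
      (range_cons_shift (hM _ (by omega)))

/-! ### Labels attached to a critical degree -/

theorem mem_ladderSet_of_critical {M : MayaDiagram} {q : ℕ} (hq : q ∈ criticalDegrees M.carrier)
    {m : ℤ} : m ∈ M.ladderSet q ↔ m - q ∈ M.carrier ∧ m ∉ M.carrier := by
  rw [ladderSet, Set.Finite.mem_toFinset, Set.mem_symmDiff]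
  exact or_iff_left fun h => h.2 (hq.2 m h.1)

theorem mem_shiftDiff {M : MayaDiagram} {n m : ℤ} :
    m ∈ M.shiftDiff n ↔ m - n ∈ M.carrier ∧ m ∉ M.carrier := by
  rw [shiftDiff, Set.Finite.mem_toFinset]
  rfl

theorem shiftDiff_eq_ladderSet {M : MayaDiagram} {q : ℕ} (hq : q ∈ criticalDegrees M.carrier) :
    M.shiftDiff q = M.ladderSet q := by
  ext m
  rw [mem_shiftDiff, mem_ladderSet_of_critical hq]

/-- Since `M ⊆ M + q`, the cutoff `n` also serves `M + q`, whose labels are the old ones together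
with the `k ∈ (M + q) \ M`. -/
theorem IsLabelling.append {M : MayaDiagram} {n r : ℕ} {t : Fin r → ℤ} (h : M.IsLabelling n t)
    {q : ℕ} (hq : q ∈ criticalDegrees M.carrier) :
    (M.shift q).IsLabelling n (Fin.append t ((M.ladderSet q).orderEmbOfFin rfl)) where
  lower m hm := hq.2 m (h.lower m hm)
  injective := by
    rw [Fin.append_injective_iff]
    refine ⟨h.injective, ((M.ladderSet q).orderEmbOfFin rfl).injective, fun i j hij => ?_⟩
    have h₁ := (mem_ladderSet_of_critical hq).1 (Finset.orderEmbOfFin_mem (M.ladderSet q) rfl j)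
    have h₂ := (h.range_iff _).1 (Set.mem_range_self i)
    exact h₁.2 (hij ▸ h₂.1)
  range_iff m := by
    have h₁ : m ∈ Set.range (Fin.append t ((M.ladderSet q).orderEmbOfFin rfl)) ↔
        m ∈ Set.range t ∨ m ∈ Set.range ((M.ladderSet q).orderEmbOfFin rfl) := by
      simp only [Set.mem_range]
      constructor
      · rintro ⟨i, rfl⟩
        refine Fin.addCases (fun i => ?_) (fun j => ?_) i <;> simp
      · rintro (⟨i, rfl⟩ | ⟨j, rfl⟩)
        · exact ⟨Fin.castAdd _ i, by simp⟩
        · exact ⟨Fin.natAdd _ j, by simp⟩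
    rw [h₁, h.range_iff, Finset.range_orderEmbOfFin, Finset.mem_coe, mem_ladderSet_of_critical hq,
      mem_shift]
    by_cases hm : m ∈ M.carrier
    · have := hq.2 m hm
      tauto
    · have : -(n : ℤ) ≤ m := by
        by_contra h₂
        exact hm (h.lower m (not_le.1 h₂))
      tauto

/-- `(M + q) \ M` has `q` elements for a critical degree `q`. -/
theorem card_ladderSet {M : MayaDiagram} {q : ℕ} (hq : q ∈ criticalDegrees M.carrier) :
    (M.ladderSet q).card = q := by
  obtain ⟨n, r, t, h⟩ := M.exists_isLabelling
  -- Beyond the cutoff, each unit translation brings in one new non-negative member, so the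
  -- labellings of `M + q` and `M` differ in length by `q`.
  have h₁ := card_eq_of_range_eq (h.append hq).injective_shift (h.append hq).range_shift
  have h₂ := card_eq_of_range_eq h.injective_shift h.range_shift
  rw [shift_shift, add_comm (q : ℤ), ← shift_shift,
    card_kPos_shift (M := M.shift n) (fun m hm => h.lower _ (by omega)), h₂] at h₁
  omega

end MayaDiagram

/-! ### Composition of Wronskian operators -/

section DiffOps

variable {k R : Type*} [CommRing k] [CommRing R] [Algebra k R] {D : Module.End k R}

/-- Crum's formula is applied to `g` and to `g` followed by `y`; the common factor `ringWr D f`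
cancels in the quotient. -/
theorem ringWrOp_comp_ringWrOp (hD : ∀ a b, D (a * b) = a * D b + b * D a) {m n : ℕ}
    {f : Fin m → R} (hf : IsUnit (ringWr D f)) (g : Fin n → R) (y : R) :
    ringWrOp D (fun i => ringWrOp D f (g i)) (ringWrOp D f y) =
      ringWrOp D (Fin.append f g) y := by
  have h₁ : (Fin.snoc (Fin.append f g) y : Fin (m + n + 1) → R) =
      Fin.append f (Fin.snoc g y : Fin (n + 1) → R) := (Fin.append_snoc ..).symm
  have h₂ := ringWr_append hD hf (Fin.snoc g y : Fin (n + 1) → R)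
  have h₃ : (fun i => ringWrOp D f ((Fin.snoc g y : Fin (n + 1) → R) i)) =
      (Fin.snoc (fun i => ringWrOp D f (g i)) (ringWrOp D f y) : Fin (n + 1) → R) :=
    Fin.comp_snoc (ringWrOp D f) g y
  rw [h₃, ← h₁] at h₂
  rw [ringWrOp, ringWrOp.eq_1 D (Fin.append f g), ringWr_append hD hf, h₂,
    Ring.mul_inverse_rev, mul_assoc, Ring.inverse_mul_cancel_left _ _ hf]

/-- Numerator and denominator acquire the same constants `c i`, and the numerator one more factor
`u` and the constant `c'`. This removes the Gaussian and the normalizations from the bound states.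
-/
theorem ringWrOp_smul_mul (hD : ∀ a b, D (a * b) = a * D b + b * D a) {n : ℕ} {f : Fin n → R}
    (hf : IsUnit (ringWr D f)) {c : Fin n → k} (hc : IsUnit (∏ i, c i)) {u : R} (hu : IsUnit u)
    (c' : k) (y : R) :
    ringWrOp D (fun i => c i • (u * f i)) (c' • (u * y)) = c' • (u * ringWrOp D f y) := by
  have h₁ : ringWr D (fun i => c i • (u * f i)) =
      algebraMap k R (∏ i, c i) * (u ^ n * ringWr D f) := by
    rw [ringWr_smul c fun i => u * f i, ringWr_mul hD hu, Algebra.smul_def]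
  have h₂ : (Fin.snoc (fun i => c i • (u * f i)) (c' • (u * y)) : Fin (n + 1) → R) =
      fun i => (Fin.snoc c c' : Fin (n + 1) → k) i •
        (u * (Fin.snoc f y : Fin (n + 1) → R) i) := by
    funext i
    refine Fin.lastCases ?_ (fun i => ?_) i <;> simp
  have h₃ : IsUnit (algebraMap k R (∏ i, c i) * (u ^ n * ringWr D f)) :=
    (hc.map _).mul ((hu.pow n).mul hf)
  rw [ringWrOp, h₁, h₂, ringWr_smul _ fun i => u * (Fin.snoc f y : Fin (n + 1) → R) i,
    ringWr_mul hD hu, Fin.prod_univ_castSucc]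
  apply h₃.mul_left_cancel
  rw [Ring.mul_inverse_cancel_left _ _ h₃, ringWrOp]
  simp only [Fin.snoc_castSucc, Fin.snoc_last, Algebra.smul_def, map_mul]
  linear_combination -(algebraMap k R (∏ i, c i) * algebraMap k R c' * u ^ (n + 1) *
    ringWr D (Fin.snoc f y : Fin (n + 1) → R)) * Ring.mul_inverse_cancel _ hf

end DiffOps

/-! ### Hermite Wronskians do not vanish identically -/

open Filter Topology

theorem tendsto_hermiteH_div_pow (n : ℕ) :
    Tendsto (fun x => hermiteH n x / x ^ n) atTop (𝓝 (2 ^ n)) := by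
  have h₁ : hermiteH 1 = fun x => 2 * x := by
    funext x
    have h := (hasDerivAt_hermiteH_succ' 0 x).deriv
    simp only [hermiteH_zero, deriv_const] at h
    simp only [zero_add, mul_one] at h
    linarith
  induction n using Nat.twoStepInduction with
  | zero => simp [hermiteH_zero]
  | one =>
    refine Tendsto.congr' ?_ tendsto_const_nhds
    filter_upwards [eventually_ne_atTop 0] with x hx
    rw [h₁]
    field_simp
  | more n ih₁ ih₂ =>
    have h₂ : Tendsto (fun x : ℝ => (x ^ 2)⁻¹) atTop (𝓝 0) :=
      (tendsto_pow_atTop two_ne_zero).inv_tendsto_atTop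
    have h₃ := (ih₂.const_mul 2).sub ((ih₁.mul h₂).const_mul (2 * (n + 1) : ℝ))
    have h₄ : (2 : ℝ) * 2 ^ (n + 1) - 2 * (n + 1) * (2 ^ n * 0) = 2 ^ (n + 2) := by ring
    rw [h₄] at h₃
    refine h₃.congr' ?_
    filter_upwards [eventually_ne_atTop 0] with x hx
    rw [hermiteH_add_two]
    field_simp
    ring

theorem iteratedDeriv_hermiteH (n j : ℕ) : iteratedDeriv j (hermiteH n) =
    fun x => 2 ^ j * (n.descFactorial j : ℝ) * hermiteH (n - j) x := by
  induction j with
  | zero => simp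
  | succ j ih =>
    rw [iteratedDeriv_succ, ih]
    funext x
    rw [deriv_const_mul_field', Nat.descFactorial_succ]
    rcases Nat.eq_zero_or_pos (n - j) with h | h
    · simp [h, hermiteH_zero]
    · obtain ⟨i, hi⟩ := Nat.exists_eq_succ_of_ne_zero h.ne'
      have h₂ : n - (j + 1) = i := by omega
      rw [hi, h₂, Nat.succ_eq_add_one, deriv_hermiteH_succ]
      push_cast
      ring

/-- Scale the entry `(i, j)` by `x^{j - d_i}` and let `x → ∞`: the limit is `2^{d_i}` times the
falling factorial of `d_i` of length `j`. Falling factorials are monic polynomials in `d_i`, so the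
limiting determinant is a nonzero multiple of the Vandermonde determinant of distinct degrees. -/
theorem exists_wronskian_hermiteH_ne_zero {r : ℕ} {d : Fin r → ℕ} (hd : Function.Injective d) :
    ∃ x, wronskian (fun i => hermiteH (d i)) x ≠ 0 := by
  by_contra! h
  have hlim : ∀ i j : Fin r, Tendsto
      (fun x : ℝ => (x ^ d i)⁻¹ * (x ^ (j : ℕ) * iteratedDeriv j (hermiteH (d i)) x)) atTop
      (𝓝 (2 ^ d i * ((d i).descFactorial j : ℝ))) := by
    intro i j
    rw [iteratedDeriv_hermiteH]
    rcases lt_or_ge (d i) (j : ℕ) with hij | hij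
    · simp [Nat.descFactorial_eq_zero_iff_lt.2 hij]
    · have h₁ := (tendsto_hermiteH_div_pow (d i - j)).const_mul
        (2 ^ (j : ℕ) * ((d i).descFactorial j : ℝ))
      have h₂ : (2 : ℝ) ^ d i = 2 ^ (j : ℕ) * 2 ^ (d i - j) := by
        rw [← pow_add, Nat.add_sub_cancel' hij]
      rw [h₂]
      have h₄ : 2 ^ (j : ℕ) * ((d i).descFactorial j : ℝ) * 2 ^ (d i - j) =
        2 ^ (j : ℕ) * 2 ^ (d i - j) * ((d i).descFactorial j : ℝ) := by ring
      rw [h₄] at h₁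
      refine h₁.congr' ?_
      filter_upwards [eventually_ne_atTop 0] with x hx
      have h₃ : x ^ d i = x ^ (j : ℕ) * x ^ (d i - j) := by
        rw [← pow_add, Nat.add_sub_cancel' hij]
      rw [h₃]
      field_simp
  have hdet : Tendsto (fun x : ℝ => (Matrix.of fun i j : Fin r =>
      (x ^ d i)⁻¹ * (x ^ (j : ℕ) * iteratedDeriv j (hermiteH (d i)) x)).det) atTop
      (𝓝 (Matrix.of fun i j : Fin r => 2 ^ d i * ((d i).descFactorial j : ℝ)).det) := by
    refine ((continuous_id.matrix_det).tendsto _).comp ?_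
    exact tendsto_pi_nhds.2 fun i => tendsto_pi_nhds.2 fun j => hlim i j
  have hzero : ∀ x : ℝ, (Matrix.of fun i j : Fin r =>
      (x ^ d i)⁻¹ * (x ^ (j : ℕ) * iteratedDeriv j (hermiteH (d i)) x)).det = 0 := by
    intro x
    have h₁ := Matrix.det_mul_column (fun i => (x ^ d i)⁻¹)
      (Matrix.of fun i j : Fin r => x ^ (j : ℕ) * iteratedDeriv j (hermiteH (d i)) x)
    have h₂ := Matrix.det_mul_row (fun j : Fin r => x ^ (j : ℕ))
      (Matrix.of fun i j : Fin r => iteratedDeriv j (hermiteH (d i)) x)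
    have h₃ := h x
    rw [wronskian] at h₃
    simp only [Matrix.of_apply] at h₁ h₂
    rw [h₁, h₂, h₃, mul_zero, mul_zero]
  have h₄ := tendsto_nhds_unique (hdet.congr hzero) tendsto_const_nhds
  have h₅ := Matrix.det_mul_column (fun i => (2 : ℝ) ^ d i)
    (Matrix.of fun i j : Fin r => ((d i).descFactorial j : ℝ))
  simp only [Matrix.of_apply] at h₅
  have h₆ := Matrix.det_eval_matrixOfPolynomials_eq_det_vandermonde (fun i => (d i : ℝ))
    (fun j => descPochhammer ℝ j) (fun j => by simp)
    (fun j => monic_descPochhammer ℝ j)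
  simp only [descPochhammer_eval_eq_descFactorial] at h₆
  rw [h₅, ← h₆] at h₄
  have h₇ : (Matrix.vandermonde fun i => (d i : ℝ)).det ≠ 0 := by
    rw [Matrix.det_vandermonde_ne_zero_iff]
    exact Nat.cast_injective.comp hd
  exact mul_ne_zero (Finset.prod_ne_zero_iff.2 fun i _ => by positivity) h₇ h₄

namespace MayaDiagram

theorem exists_mem_domain (M : MayaDiagram) : ∃ x, x ∈ M.domain := by
  obtain ⟨n, r, t, h⟩ := M.exists_isLabelling
  have h₁ : ∀ i, -(n : ℤ) ≤ t i := fun i => ((h.range_iff _).1 (Set.mem_range_self i)).2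
  obtain ⟨x, hx⟩ := exists_wronskian_hermiteH_ne_zero (d := fun i => (t i + n).toNat)
    fun i j hij => h.injective (by
      have := h₁ i
      have := h₁ j
      simp only at hij
      omega)
  refine ⟨x, ?_⟩
  change M.hatH x ≠ 0
  rw [h.hatH_eq]
  exact div_ne_zero hx (vdm_ne_zero h.injective)

/-! ### Bound states as images of Hermite functions -/

variable (𝕜 : Type*) [RCLike 𝕜]

/-- The Gaussian `e^{-x²/2}`. -/
def gaussian (U : TopologicalSpace.Opens ℝ) : Smooth 𝕜 U :=
  Smooth.ofReal 𝕜 U (fun x => Real.exp (-x ^ 2 / 2)) (by fun_prop)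

/-- The Hermite polynomial with label `m + n`. -/
def hermiteS (U : TopologicalSpace.Opens ℝ) (n : ℕ) (m : ℤ) : Smooth 𝕜 U :=
  Smooth.ofReal 𝕜 U (hermiteH (m + n).toNat) (contDiff_hermiteH _)

variable {𝕜} {U : TopologicalSpace.Opens ℝ}

theorem isUnit_gaussian : IsUnit (gaussian 𝕜 U) :=
  Smooth.isUnit_of_ne_zero _ fun x => by
    have := (Real.exp_pos (-(x : ℝ) ^ 2 / 2)).ne'
    rw [gaussian, Smooth.ofReal_apply]
    exact_mod_cast this

theorem ringWr_hermiteS (n : ℕ) {r : ℕ} (t : Fin r → ℤ) :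
    ringWr (Dx 𝕜 U) (fun i => hermiteS 𝕜 U n (t i)) =
      Smooth.ofReal 𝕜 U (hermiteWr n t) (contDiff_hermiteWr n t) :=
  ringWr_ofReal 𝕜 U _ fun _ => contDiff_hermiteH _

theorem IsLabelling.hermiteWr_ne_zero {N : MayaDiagram} {n r : ℕ} {t : Fin r → ℤ}
    (h : N.IsLabelling n t) {x : ℝ} (hx : N.hatH x ≠ 0) : hermiteWr n t x ≠ 0 := by
  rw [h.hatH_eq] at hx
  exact fun h₁ => hx (by rw [h₁, zero_div])

theorem IsLabelling.isUnit_ringWr {N : MayaDiagram} {n r : ℕ} {t : Fin r → ℤ}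
    (h : N.IsLabelling n t) (hU : ∀ x : U, N.hatH x ≠ 0) :
    IsUnit (ringWr (Dx 𝕜 U) fun i => hermiteS 𝕜 U n (t i)) := by
  rw [ringWr_hermiteS]
  refine Smooth.isUnit_of_ne_zero _ fun x => ?_
  rw [Smooth.ofReal_apply]
  exact_mod_cast h.hermiteWr_ne_zero (hU x)

theorem IsLabelling.ringWrOp_apply {N : MayaDiagram} {n r : ℕ} {t : Fin r → ℤ}
    (h : N.IsLabelling n t) (hU : ∀ x : U, N.hatH x ≠ 0) (m : ℤ) (x : U) :
    (ringWrOp (Dx 𝕜 U) (fun i => hermiteS 𝕜 U n (t i)) (hermiteS 𝕜 U n m) : Smooth 𝕜 U).1 x =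
      ((hermiteWr n (Fin.snoc t m : Fin (r + 1) → ℤ) x / hermiteWr n t x : ℝ) : 𝕜) := by
  have h₁ : (Fin.snoc (fun i => hermiteS 𝕜 U n (t i)) (hermiteS 𝕜 U n m) :
      Fin (r + 1) → Smooth 𝕜 U) = fun i => hermiteS 𝕜 U n ((Fin.snoc t m : Fin (r + 1) → ℤ) i) :=
    (Fin.comp_snoc (hermiteS 𝕜 U n) t m).symm
  have h₂ := Ring.mul_inverse_cancel_left _ (ringWr (Dx 𝕜 U)
    (Fin.snoc (fun i => hermiteS 𝕜 U n (t i)) (hermiteS 𝕜 U n m) : Fin (r + 1) → Smooth 𝕜 U))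
    (h.isUnit_ringWr (𝕜 := 𝕜) hU)
  rw [← ringWrOp, h₁, ringWr_hermiteS, ringWr_hermiteS] at h₂
  have h₃ := congrFun (congrArg (fun g : Smooth 𝕜 U => (g : U → 𝕜)) h₂) x
  change ((hermiteWr n t x : ℝ) : 𝕜) * _ = ((hermiteWr n _ x : ℝ) : 𝕜) at h₃
  have h₄ : ((hermiteWr n t x : ℝ) : 𝕜) ≠ 0 := by
    exact_mod_cast h.hermiteWr_ne_zero (hU x)
  rw [RCLike.ofReal_div, eq_div_iff h₄, mul_comm, h₃]

/-- The open set `U` is kept independent of `N`, so that states of `M` and of `M + q` can be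
compared on the domain of `M`. -/
theorem IsLabelling.eq_smul_ringWrOp {N : MayaDiagram} {n r : ℕ} {t : Fin r → ℤ}
    (h : N.IsLabelling n t) (hU : ∀ x : U, N.hatH x ≠ 0) {m : ℤ} (hm : m ∉ N.carrier)
    {g : Smooth 𝕜 U} (hg : ∀ x : U, (g : U → 𝕜) x =
      ((Real.exp (-(x : ℝ) ^ 2 / 2) * (N.flip m).hatH x / N.hatH x : ℝ) : 𝕜)) :
    g = (∏ i, 2 * ((m : 𝕜) - t i))⁻¹ • (gaussian 𝕜 U *
      ringWrOp (Dx 𝕜 U) (fun i => hermiteS 𝕜 U n (t i)) (hermiteS 𝕜 U n m)) := by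
  ext x
  have h₁ : (((gaussian 𝕜 U : Smooth 𝕜 U) : U → 𝕜) x) =
      ((Real.exp (-(x : ℝ) ^ 2 / 2) : ℝ) : 𝕜) := rfl
  rw [hg, mul_div_assoc, h.hatH_flip_div hm]
  simp only [SetLike.val_smul, Pi.smul_apply, MulMemClass.coe_mul, Pi.mul_apply, smul_eq_mul, h₁,
    h.ringWrOp_apply hU]
  push_cast
  ring

variable (𝕜)

theorem psi_apply {M : MayaDiagram} {m : ℤ} (hm : m ∉ M.carrier) (x : M.domain) :
    (M.psi 𝕜 m : M.domain → 𝕜) x =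
      ((Real.exp (-(x : ℝ) ^ 2 / 2) * (M.flip m).hatH x / M.hatH x : ℝ) : 𝕜) := by
  change ((Real.exp (M.eps m * (x : ℝ) ^ 2 / 2) * (M.flip m).hatH x / M.hatH x : ℝ) : 𝕜) = _
  rw [eps, if_neg hm, neg_one_mul]

theorem flip_shift {M : MayaDiagram} {m : ℤ} (n : ℤ) (hm : m ∉ (M.shift n).carrier) :
    (M.flip (m - n)).shift n = (M.shift n).flip m :=
  ext_carrier fun k => by
    rw [mem_flip hm, mem_shift, mem_flip (M := M) (k := m - n) hm, sub_left_inj, mem_shift]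

theorem IsLabelling.psi_eq {M : MayaDiagram} {n r : ℕ} {t : Fin r → ℤ} (h : M.IsLabelling n t)
    {m : ℤ} (hm : m ∉ M.carrier) :
    M.psi 𝕜 m = (∏ i, 2 * ((m : 𝕜) - t i))⁻¹ • (gaussian 𝕜 M.domain *
      ringWrOp (Dx 𝕜 M.domain) (fun i => hermiteS 𝕜 M.domain n (t i))
        (hermiteS 𝕜 M.domain n m)) :=
  h.eq_smul_ringWrOp (fun x => x.2) hm (psi_apply 𝕜 hm)

/-- By translation invariance, flipping `m - q` in `M` amounts to flipping `m` in `M + q`. So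
`ψ_{M,m-q}` comes from the same Hermite polynomial as `ψ_{M,m}`, with the labels of `M + q`. -/
theorem IsLabelling.psi_sub_eq {M : MayaDiagram} {n r q : ℕ} {t : Fin r → ℤ}
    (h : (M.shift q).IsLabelling n t) {m : ℤ} (hm : m - q ∉ M.carrier) :
    M.psi 𝕜 (m - q) = (∏ i, 2 * ((m : 𝕜) - t i))⁻¹ • (gaussian 𝕜 M.domain *
      ringWrOp (Dx 𝕜 M.domain) (fun i => hermiteS 𝕜 M.domain n (t i))
        (hermiteS 𝕜 M.domain n m)) := by
  refine h.eq_smul_ringWrOp (fun x => ?_) hm fun x => ?_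
  · rw [hatH_shift]
    exact x.2
  · rw [psi_apply 𝕜 hm, hatH_shift, ← flip_shift _ hm, hatH_shift]

/-- The elements of `(M + q) \ M` for a critical degree `q`. -/
def ladderEnum (M : MayaDiagram) (q : ℕ) : Fin (M.ladderSet q).card → ℤ :=
  (M.ladderSet q).orderEmbOfFin rfl

theorem ladderEnum_mem {M : MayaDiagram} {q : ℕ} (hq : q ∈ criticalDegrees M.carrier) (i) :
    M.ladderEnum q i - q ∈ M.carrier ∧ M.ladderEnum q i ∉ M.carrier :=
  (mem_ladderSet_of_critical hq).1 (Finset.orderEmbOfFin_mem _ rfl i)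

theorem IsLabelling.prod_ne_zero {M : MayaDiagram} {n r : ℕ} {t : Fin r → ℤ}
    (h : M.IsLabelling n t) {m : ℤ} (hm : m ∉ M.carrier) : ∏ i, 2 * ((m : 𝕜) - t i) ≠ 0 := by
  refine Finset.prod_ne_zero_iff.2 fun i _ => mul_ne_zero two_ne_zero ?_
  rw [sub_ne_zero]
  intro h₁
  have h₂ : m = t i := by exact_mod_cast h₁
  exact hm (h₂ ▸ ((h.range_iff _).1 (Set.mem_range_self i)).1)

theorem hermiteS_append (M : MayaDiagram) (U : TopologicalSpace.Opens ℝ) (n : ℕ) {r : ℕ}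
    (t : Fin r → ℤ) (q : ℕ) :
    (fun i => hermiteS 𝕜 U n (Fin.append t ((M.ladderSet q).orderEmbOfFin rfl) i)) =
      Fin.append (fun i => hermiteS 𝕜 U n (t i)) fun i => hermiteS 𝕜 U n (M.ladderEnum q i) := by
  funext i
  refine Fin.addCases (fun i => ?_) (fun j => ?_) i <;> simp [ladderEnum]

/-- By Crum's formula this is a factor of the Hermite Wronskian of `M + q`. The latter is a nonzero
constant times `Ĥ_{M+q} = Ĥ_M`, hence a unit on `U_M`. -/
theorem IsLabelling.isUnit_ringWr_ladderEnum {M : MayaDiagram} {n r : ℕ} {t : Fin r → ℤ}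
    (h : M.IsLabelling n t) {q : ℕ} (hq : q ∈ criticalDegrees M.carrier) :
    IsUnit (ringWr (Dx 𝕜 M.domain) fun i =>
      ringWrOp (Dx 𝕜 M.domain) (fun i => hermiteS 𝕜 M.domain n (t i))
        (hermiteS 𝕜 M.domain n (M.ladderEnum q i))) := by
  have h₂ := (h.append hq).isUnit_ringWr (𝕜 := 𝕜) (U := M.domain) fun x => by
    rw [hatH_shift]
    exact x.2
  have hf := h.isUnit_ringWr (𝕜 := 𝕜) (U := M.domain) fun x => x.2
  rw [hermiteS_append, ringWr_append Dx_mul hf] at h₂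
  exact isUnit_of_mul_isUnit_right h₂

theorem isUnit_ringWr_psi {M : MayaDiagram} {q : ℕ} (hq : q ∈ criticalDegrees M.carrier) :
    IsUnit (ringWr (Dx 𝕜 M.domain) fun i => M.psi 𝕜 (M.ladderEnum q i)) := by
  obtain ⟨n, r, t, h⟩ := M.exists_isLabelling
  have h₁ : (fun i => M.psi 𝕜 (M.ladderEnum q i)) = fun i => _ :=
    funext fun i => h.psi_eq 𝕜 (ladderEnum_mem hq i).2
  have hf := h.isUnit_ringWr (𝕜 := 𝕜) (U := M.domain) fun x => x.2
  have h₂ := h.isUnit_ringWr_ladderEnum 𝕜 hq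
  rw [h₁, ringWr_smul, ringWr_mul Dx_mul isUnit_gaussian, Algebra.smul_def]
  refine IsUnit.mul (IsUnit.map _ (IsUnit.mk0 _ ?_))
    ((isUnit_gaussian.pow _).mul (h₂))
  exact Finset.prod_ne_zero_iff.2 fun i _ =>
    inv_ne_zero (h.prod_ne_zero 𝕜 (ladderEnum_mem hq i).2)

theorem ladder_apply {M : MayaDiagram} {q : ℕ} (y : Smooth 𝕜 M.domain) :
    M.ladder 𝕜 q y = ringWrOp (Dx 𝕜 M.domain) (fun i => M.psi 𝕜 (M.ladderEnum q i)) y := rfl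

theorem ladder_psi {M : MayaDiagram} {q : ℕ} (hq : q ∈ criticalDegrees M.carrier) {m : ℤ}
    (hm : m ∉ M.carrier) :
    M.ladder 𝕜 q (M.psi 𝕜 m) = ((2 : 𝕜) ^ q * M.gamma 𝕜 q (m : 𝕜)) • M.psi 𝕜 (m - q) := by
  -- Here `m` lies in `(M + q) \ M`: `ψ_{M,m}` is one of the functions defining the operator, and
  -- `γ(m)` has a zero factor.
  by_cases hmq : m - q ∈ M.carrier
  · have h₁ : m ∈ M.ladderSet q := (mem_ladderSet_of_critical hq).2 ⟨hmq, hm⟩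
    have h₂ : m ∈ Set.range (M.ladderEnum q) := by
      rw [ladderEnum, Finset.range_orderEmbOfFin]
      exact h₁
    obtain ⟨i, rfl⟩ := h₂
    rw [ladder_apply, ringWrOp_self _ i, gamma, shiftDiff_eq_ladderSet hq,
      Finset.prod_eq_zero (f := fun k : ℤ => ((M.ladderEnum q i : ℤ) : 𝕜) - (k : 𝕜)) h₁ (sub_self _),
      mul_zero, zero_smul]
  obtain ⟨n, r, t, h⟩ := M.exists_isLabelling
  have h₁ : (fun i => M.psi 𝕜 (M.ladderEnum q i)) = fun i => _ :=
    funext fun i => h.psi_eq 𝕜 (ladderEnum_mem hq i).2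
  have hf := h.isUnit_ringWr (𝕜 := 𝕜) (U := M.domain) fun x => x.2
  have h₂ := h.isUnit_ringWr_ladderEnum 𝕜 hq
  have hc : IsUnit (∏ i, (∏ j, 2 * ((M.ladderEnum q i : 𝕜) - t j))⁻¹) :=
    IsUnit.mk0 _ (Finset.prod_ne_zero_iff.2 fun i _ =>
      inv_ne_zero (h.prod_ne_zero 𝕜 (ladderEnum_mem hq i).2))
  -- The normalization product for `M + q` splits into the one for `M` and the `q` factors `2(m -
  -- k)` of the appended labels; their quotient is the ladder constant.
  have h₄ : ∏ i, 2 * ((m : 𝕜) - (Fin.append t ((M.ladderSet q).orderEmbOfFin rfl) i : ℤ)) =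
      (∏ i, 2 * ((m : 𝕜) - t i)) * ((2 : 𝕜) ^ q * M.gamma 𝕜 q (m : 𝕜)) := by
    rw [Fin.prod_univ_add]
    simp only [Fin.append_left, Fin.append_right]
    congr 1
    rw [Finset.prod_mul_distrib, Finset.prod_const, Finset.card_univ, Fintype.card_fin,
      gamma, shiftDiff_eq_ladderSet hq]
    refine congrArg₂ (· * ·) (by rw [card_ladderSet hq]) ?_
    rw [← Finset.prod_coe_sort (M.ladderSet q)]
    exact Fintype.prod_equiv ((M.ladderSet q).orderIsoOfFin rfl).toEquiv _ _ fun i => rfl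
  have h₅ := (h.append hq).prod_ne_zero 𝕜 hmq
  have h₆ := h.prod_ne_zero 𝕜 hm
  rw [(h.append hq).psi_sub_eq 𝕜 hmq, ladder_apply, h₁, h.psi_eq 𝕜 hm,
    ringWrOp_smul_mul Dx_mul (h₂) hc isUnit_gaussian,
    ringWrOp_comp_ringWrOp Dx_mul hf, hermiteS_append, smul_smul]
  rw [h₄] at h₅ ⊢
  congr 1
  have h₇ := right_ne_zero_of_mul h₅
  rw [mul_inv, mul_left_comm, mul_inv_cancel₀ h₇, mul_one]

/-! ### The partition of a Maya diagram -/

/-- The number of members of `M` above `m`. -/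
def countAbove (M : MayaDiagram) (m : ℤ) : ℕ := {k : ℤ | k ∈ M.carrier ∧ m < k}.ncard

theorem finite_above (M : MayaDiagram) (m : ℤ) : {k : ℤ | k ∈ M.carrier ∧ m < k}.Finite := by
  refine (M.finite_pos.union (Set.finite_Ioo m 0)).subset ?_
  rintro k ⟨hk, h⟩
  rcases le_or_gt 0 k with h₀ | h₀
  · exact Or.inl ⟨hk, h₀⟩
  · exact Or.inr ⟨h, h₀⟩

theorem countAbove_lt (M : MayaDiagram) {a b : ℤ} (hb : b ∈ M.carrier) (hab : a < b) :
    M.countAbove b < M.countAbove a := by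
  refine Set.ncard_lt_ncard ?_ (M.finite_above a)
  refine ⟨fun k hk => ⟨hk.1, hab.trans hk.2⟩, fun h => ?_⟩
  exact lt_irrefl b (h ⟨hb, hab⟩).2

theorem exists_mem_lt (M : MayaDiagram) (b : ℤ) : ∃ m ∈ M.carrier, m < b := by
  by_contra! h
  refine Set.Iio_infinite (min b 0) (M.finite_neg.subset fun m hm => ?_)
  have h₁ : m < min b 0 := hm
  rw [lt_min_iff] at h₁
  exact ⟨fun h₂ => absurd (h m h₂) (not_le.2 h₁.1), h₁.2⟩

theorem exists_greatest_lt (M : MayaDiagram) (b : ℤ) :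
    ∃ m, (m ∈ M.carrier ∧ m < b) ∧ ∀ k, k ∈ M.carrier ∧ k < b → k ≤ m :=
  Int.exists_greatest_of_bdd ⟨b, fun _ h => h.2.le⟩ (M.exists_mem_lt b)

/-- Start at the maximum of `M` and repeatedly pass to the greatest smaller member. -/
theorem exists_countAbove_eq (M : MayaDiagram) (i : ℕ) :
    ∃ m ∈ M.carrier, M.countAbove m = i := by
  induction i with
  | zero =>
    obtain ⟨b, hb⟩ := M.finite_pos.bddAbove
    obtain ⟨m, hm, h⟩ := M.exists_greatest_lt (max b 0 + 1)
    refine ⟨m, hm.1, ?_⟩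
    rw [countAbove, Set.ncard_eq_zero (M.finite_above m), Set.eq_empty_iff_forall_notMem]
    rintro k ⟨hk, hmk⟩
    refine absurd (h k ⟨hk, ?_⟩) (not_le.2 hmk)
    rcases le_or_gt 0 k with h₀ | h₀
    · have := hb ⟨hk, h₀⟩
      have := le_max_left b 0
      omega
    · have := le_max_right b 0
      omega
  | succ i ih =>
    obtain ⟨b, hb, rfl⟩ := ih
    obtain ⟨m, hm, h⟩ := M.exists_greatest_lt b
    refine ⟨m, hm.1, ?_⟩
    have h₁ : {k : ℤ | k ∈ M.carrier ∧ m < k} = insert b {k : ℤ | k ∈ M.carrier ∧ b < k} := by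
      ext k
      simp only [Set.mem_ofPred_eq, Set.mem_insert_iff]
      constructor
      · rintro ⟨hk, hmk⟩
        rcases lt_trichotomy k b with h₂ | h₂ | h₂
        · exact absurd (h k ⟨hk, h₂⟩) (not_le.2 hmk)
        · exact Or.inl h₂
        · exact Or.inr ⟨hk, h₂⟩
      · rintro (rfl | ⟨hk, h₂⟩)
        · exact ⟨hb, hm.2⟩
        · exact ⟨hk, hm.2.trans h₂⟩
    rw [countAbove, h₁, Set.ncard_insert_of_notMem (fun h₂ => lt_irrefl _ h₂.2)
      (M.finite_above b), countAbove]

/-- `countAbove` is strictly decreasing on `M`, so the supremum in `enum` is taken over a singleton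
and no default value intervenes. -/
theorem enum_countAbove (M : MayaDiagram) {m : ℤ} (hm : m ∈ M.carrier) :
    M.enum (M.countAbove m + 1) = m := by
  have h : {k : ℤ | k ∈ M.carrier ∧ {l : ℤ | l ∈ M.carrier ∧ k < l}.ncard + 1 =
      M.countAbove m + 1} = {m} := by
    ext k
    simp only [Set.mem_ofPred_eq, Set.mem_singleton_iff]
    constructor
    · rintro ⟨hk, h⟩
      have h₁ : M.countAbove k = M.countAbove m := Nat.succ_injective h
      rcases lt_trichotomy k m with h₂ | h₂ | h₂
      · exact absurd h₁ (M.countAbove_lt hm h₂).ne'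
      · exact h₂
      · exact absurd h₁ (M.countAbove_lt hk h₂).ne
    · rintro rfl
      exact ⟨hm, rfl⟩
  rw [enum, h, csSup_singleton]

/-- Since `λ_i - i = m_i - σ_M`, the diagram of the partition is a translate of `M`, and critical
degrees do not see translations. -/
theorem mem_mayaSet_partition (M : MayaDiagram) (m : ℤ) :
    m ∈ mayaSet M.partition ↔ m + M.index ∈ M.carrier := by
  constructor
  · rintro ⟨i, hi, rfl⟩
    obtain ⟨j, rfl⟩ := Nat.exists_eq_add_of_le' hi
    obtain ⟨k, hk, rfl⟩ := M.exists_countAbove_eq j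
    rw [partition, M.enum_countAbove hk]
    convert hk using 1
    ring
  · intro hm
    refine ⟨M.countAbove (m + M.index) + 1, by omega, ?_⟩
    rw [partition, M.enum_countAbove hm]
    ring

theorem critDeg_partition (M : MayaDiagram) :
    critDeg M.partition = criticalDegrees M.carrier := by
  ext q
  refine and_congr_right fun _ => ⟨fun h m hm => ?_, fun h m hm => ?_⟩
  · have h₁ := h (m - M.index) ((M.mem_mayaSet_partition _).2 (by rwa [sub_add_cancel]))
    rw [mem_mayaSet_partition] at h₁
    convert h₁ using 1
    ring
  · rw [mem_mayaSet_partition] at hm ⊢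
    have h₁ := h _ hm
    convert h₁ using 1
    ring

/-! ### The ring of annihilators -/

variable (𝕜 : Type*) [RCLike 𝕜] {M : MayaDiagram}

theorem isMonicOp_ladder {q : ℕ} (hq : q ∈ criticalDegrees M.carrier) :
    IsMonicOp (Dx 𝕜 M.domain) q (M.ladder 𝕜 q) := by
  have h : IsMonicOp (Dx 𝕜 M.domain) (M.ladderSet q).card (M.ladder 𝕜 q) :=
    isMonicOp_ringWrOp (isUnit_ringWr_psi 𝕜 hq)
  rwa [card_ladderSet hq] at h

/-- Descending from `m` by `b` and then by `a` ends in `M`, so one of the two steps leaves the bound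
labels, and the operator for that step annihilates the state. -/
theorem ladder_ladder_psi {a b : ℕ} (ha : a ∈ criticalDegrees M.carrier)
    (hb : b ∈ criticalDegrees M.carrier) {m : ℤ} (hm : m ∉ M.carrier)
    (hm' : m - (a + b : ℕ) ∈ M.carrier) : M.ladder 𝕜 a (M.ladder 𝕜 b (M.psi 𝕜 m)) = 0 := by
  have key : ∀ {q : ℕ}, q ∈ criticalDegrees M.carrier → ∀ {k : ℤ}, k ∉ M.carrier →
      k - q ∈ M.carrier → M.ladder 𝕜 q (M.psi 𝕜 k) = 0 := by
    intro q hq k hk hkq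
    rw [ladder_psi 𝕜 hq hk, gamma, Finset.prod_eq_zero
      (f := fun l : ℤ => (k : 𝕜) - (l : 𝕜)) (mem_shiftDiff.2 ⟨hkq, hk⟩) (sub_self _),
      mul_zero, zero_smul]
  by_cases h : m - b ∈ M.carrier
  · rw [key hb hm h, map_zero]
  · have h₁ : m - b - a ∈ M.carrier := by
      convert hm' using 1
      push_cast
      ring
    rw [ladder_psi 𝕜 hb hm, map_smul, key ha h h₁, smul_zero]

theorem criticalDegrees_add {S : Set ℤ} {a b : ℕ} (ha : a ∈ criticalDegrees S)
    (hb : b ∈ criticalDegrees S) : a + b ∈ criticalDegrees S := by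
  refine ⟨Nat.add_pos_left ha.1 b, fun m hm => ?_⟩
  have := hb.2 _ (ha.2 m hm)
  rwa [sub_sub, ← Nat.cast_add] at this

/-- The composite is monic of order `a + b` and annihilates the states labelled by `(M + a + b) \
M`. Their Wronskian is a unit, so these two properties determine the operator. -/
theorem ladder_mul {a b : ℕ} (ha : a ∈ criticalDegrees M.carrier)
    (hb : b ∈ criticalDegrees M.carrier) :
    M.ladder 𝕜 a * M.ladder 𝕜 b = M.ladder 𝕜 (a + b : ℕ) := by
  have hab := criticalDegrees_add ha hb
  have h : IsMonicOp (Dx 𝕜 M.domain) (M.ladderSet (a + b : ℕ)).card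
      fun y => M.ladder 𝕜 a (M.ladder 𝕜 b y) := by
    rw [card_ladderSet hab]
    exact (isMonicOp_ladder 𝕜 ha).comp Dx_mul (isMonicOp_ladder 𝕜 hb)
  have h₁ := h.eq_ringWrOp (isUnit_ringWr_psi 𝕜 hab) fun i =>
    ladder_ladder_psi 𝕜 ha hb (ladderEnum_mem hab i).2 (ladderEnum_mem hab i).1
  exact LinearMap.ext fun y => congrFun h₁ y

/-! ### Linear independence of the ladder operators -/

variable {𝕜} {U : TopologicalSpace.Opens ℝ}

/-- At `x₀` all derivatives of `(x - x₀)^N` below order `N` vanish, so only the leading term of an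
operator of order `N` survives. -/
theorem apply_sub_pow_of_isMonicOp {n N : ℕ} {P : Smooth 𝕜 U → Smooth 𝕜 U}
    (hP : IsMonicOp (Dx 𝕜 U) n P) (x₀ : U) (hn : n ≤ N) :
    (P (Smooth.ofReal 𝕜 U (fun x => (x - x₀) ^ N) (by fun_prop))).1 x₀ =
      if n = N then (N.factorial : 𝕜) else 0 := by
  obtain ⟨a, ha⟩ := hP.exists_coeff
  have h : ∀ l ≤ N, ((Dx 𝕜 U ^ l) (Smooth.ofReal 𝕜 U (fun x => (x - x₀) ^ N)
      (by fun_prop))).1 x₀ = if l = N then (N.factorial : 𝕜) else 0 := by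
    intro l hl
    rw [Dx_pow_ofReal]
    change ((iteratedDeriv l (fun x : ℝ => (x - x₀) ^ N) x₀ : ℝ) : 𝕜) = _
    have h₁ := congrFun (iteratedDeriv_comp_sub_const l (fun x : ℝ => x ^ N) (x₀ : ℝ)) x₀
    rw [h₁]
    simp only [sub_self, iteratedDeriv_fun_pow_zero]
    split_ifs <;> simp_all
  rw [ha]
  let φ : Smooth 𝕜 U →+* 𝕜 := (Pi.evalRingHom _ x₀).comp (Smooth 𝕜 U).val.toRingHom
  have hφ : ∀ g : Smooth 𝕜 U, g.1 x₀ = φ g := fun _ => rfl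
  rw [hφ, map_add, map_sum, Finset.sum_eq_zero, add_zero]
  · exact h n hn
  · intro l hl
    have hl' := Finset.mem_range.1 hl
    rw [map_mul, ← hφ ((Dx 𝕜 U ^ l) _)]
    have h₃ := h l (by omega)
    rw [if_neg (by omega)] at h₃
    rw [h₃, mul_zero]

variable (𝕜 M)

open scoped Classical in
/-- The linear map `𝕜[z] → End C^∞` that sends `z^q` to `L_M^{(q)}` for the critical degrees `q`
and to zero for all others. -/
def ladderMap : 𝕜[X] →ₗ[𝕜] Module.End 𝕜 (Smooth 𝕜 M.domain) :=
  (Polynomial.basisMonomials 𝕜).constr 𝕜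
    fun q => if q ∈ criticalDegrees M.carrier then M.ladder 𝕜 q else 0

variable {M}

theorem ladderMap_X_pow {q : ℕ} (hq : q ∈ criticalDegrees M.carrier) :
    ladderMap 𝕜 M (Polynomial.X ^ q) = M.ladder 𝕜 q := by
  classical
  have h := (Polynomial.basisMonomials 𝕜).constr_basis 𝕜
    (fun q => if q ∈ criticalDegrees M.carrier then M.ladder 𝕜 q else 0) q
  simp only [Polynomial.coe_basisMonomials, Polynomial.monomial_one_right_eq_X_pow,
    if_pos hq] at h
  rw [ladderMap]
  convert h

/-- Testing on `(x - x₀)^N` with `N` the degree of `p` isolates `N!` times the leading coefficient.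
The base point `x₀` exists because the domain is nonempty. -/
theorem ladderMap_injOn {p : 𝕜[X]} (hp : ∀ q, p.coeff q ≠ 0 → q ∈ criticalDegrees M.carrier)
    (h : ladderMap 𝕜 M p = 0) : p = 0 := by
  obtain ⟨x₀, hx₀⟩ := M.exists_mem_domain
  by_contra hp0
  have h₁ : ladderMap 𝕜 M p = ∑ q ∈ p.support, p.coeff q • M.ladder 𝕜 q := by
    conv_lhs => rw [p.as_sum_support_C_mul_X_pow]
    rw [map_sum]
    refine Finset.sum_congr rfl fun q hq => ?_
    rw [← Polynomial.smul_eq_C_mul, map_smul, ladderMap_X_pow 𝕜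
      (hp q (Polynomial.mem_support_iff.1 hq))]
  have h₂ := congrArg (fun A : Module.End 𝕜 (Smooth 𝕜 M.domain) =>
    (A (Smooth.ofReal 𝕜 M.domain (fun x => (x - x₀) ^ p.natDegree) (by fun_prop))).1 ⟨x₀, hx₀⟩)
    (h₁.symm.trans h)
  simp only [LinearMap.sum_apply, LinearMap.smul_apply, AddSubmonoidClass.coe_finsetSum,
    Finset.sum_apply, SetLike.val_smul, Pi.smul_apply, smul_eq_mul] at h₂
  rw [Finset.sum_eq_single p.natDegree] at h₂
  · rw [apply_sub_pow_of_isMonicOp (isMonicOp_ladder 𝕜 (hp _ ?_)) ⟨x₀, hx₀⟩ le_rfl, if_pos rfl] at h₂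
    · have h₃ : ((p.natDegree.factorial : ℕ) : 𝕜) ≠ 0 :=
        Nat.cast_ne_zero.2 (Nat.factorial_ne_zero _)
      exact hp0 (Polynomial.leadingCoeff_eq_zero.1 ((mul_eq_zero.1 h₂).resolve_right h₃))
    · exact Polynomial.leadingCoeff_ne_zero.2 hp0
  · intro q hq hqN
    rw [apply_sub_pow_of_isMonicOp (isMonicOp_ladder 𝕜 (hp q (Polynomial.mem_support_iff.1 hq)))
      ⟨x₀, hx₀⟩ (Polynomial.le_natDegree_of_mem_supp q hq), if_neg hqN, mul_zero]
  · intro hN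
    rw [Polynomial.notMem_support_iff.1 hN, zero_mul]

theorem coeff_of_mem_critRing {lam : ℕ → ℤ} {p : 𝕜[X]} (hp : p ∈ critRing 𝕜 lam) {q : ℕ}
    (hq : p.coeff q ≠ 0) : q ∈ critDeg lam := by
  contrapose! hq
  have hp' : p ∈ Submodule.span 𝕜 {p : 𝕜[X] | ∃ q ∈ critDeg lam, p = Polynomial.X ^ q} := hp
  induction hp' using Submodule.span_induction with
  | mem p h =>
    obtain ⟨l, hl, rfl⟩ := h
    rw [Polynomial.coeff_X_pow, if_neg]
    rintro rfl
    exact hq hl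
  | zero => simp
  | add f g hf hg h₁ h₂ => rw [Polynomial.coeff_add, h₁ hf, h₂ hg, add_zero]
  | smul c f hf h => rw [Polynomial.coeff_smul, h hf, smul_zero]

theorem ladderMap_mul {f g : 𝕜[X]} (hf : f ∈ critRing 𝕜 M.partition)
    (hg : g ∈ critRing 𝕜 M.partition) :
    ladderMap 𝕜 M (f * g) = ladderMap 𝕜 M f * ladderMap 𝕜 M g := by
  have hf' : f ∈ Submodule.span 𝕜 {p : 𝕜[X] | ∃ q ∈ critDeg M.partition, p = Polynomial.X ^ q} := hf
  have hg' : g ∈ Submodule.span 𝕜 {p : 𝕜[X] | ∃ q ∈ critDeg M.partition, p = Polynomial.X ^ q} := hg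
  clear hf hg
  induction hf', hg' using Submodule.span_induction₂ with
  | mem_mem u v hu hv =>
    obtain ⟨a, ha, rfl⟩ := hu
    obtain ⟨b, hb, rfl⟩ := hv
    rw [critDeg_partition] at ha hb
    rw [← pow_add, ladderMap_X_pow 𝕜 ha, ladderMap_X_pow 𝕜 hb,
      ladderMap_X_pow 𝕜 (criticalDegrees_add ha hb), ladder_mul 𝕜 ha hb]
  | zero_left v hv => simp
  | zero_right u hu => simp
  | add_left u₁ u₂ v _ _ _ h₁ h₂ => rw [add_mul, map_add, h₁, h₂, map_add, add_mul]
  | add_right u v₁ v₂ _ _ _ h₁ h₂ => rw [mul_add, map_add, h₁, h₂, map_add, mul_add]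
  | smul_left c u v _ _ h => rw [smul_mul_assoc, map_smul, h, map_smul, smul_mul_assoc]
  | smul_right c u v _ _ h => rw [mul_smul_comm, map_smul, h, map_smul, mul_smul_comm]

/-- The generators are closed under multiplication by `ladder_mul`, so the algebra they generate is
their linear span. -/
theorem toSubmodule_annihilatorRing :
    (M.annihilatorRing 𝕜).toSubmodule =
      Submodule.span 𝕜 {A | ∃ q ∈ criticalDegrees M.carrier, A = M.ladder 𝕜 (q : ℤ)} := by
  let S : Subsemigroup (Module.End 𝕜 (Smooth 𝕜 M.domain)) :=
    { carrier := {A | ∃ q ∈ criticalDegrees M.carrier, A = M.ladder 𝕜 (q : ℤ)}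
      mul_mem' := by
        rintro _ _ ⟨a, ha, rfl⟩ ⟨b, hb, rfl⟩
        exact ⟨a + b, criticalDegrees_add ha hb, ladder_mul 𝕜 ha hb⟩ }
  rw [annihilatorRing, NonUnitalAlgebra.adjoin_eq_span]
  exact congrArg (fun T : Subsemigroup (Module.End 𝕜 (Smooth 𝕜 M.domain)) =>
    Submodule.span 𝕜 (T : Set (Module.End 𝕜 (Smooth 𝕜 M.domain)))) (Subsemigroup.closure_eq S)

theorem map_critRing : (critRing 𝕜 M.partition).toSubmodule.map (ladderMap 𝕜 M) =
    (M.annihilatorRing 𝕜).toSubmodule := by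
  have h : (critRing 𝕜 M.partition).toSubmodule =
      Submodule.span 𝕜 {p : 𝕜[X] | ∃ q ∈ critDeg M.partition, p = Polynomial.X ^ q} := rfl
  rw [h, toSubmodule_annihilatorRing, Submodule.map_span, critDeg_partition]
  congr 1
  ext A
  constructor
  · rintro ⟨_, ⟨q, hq, rfl⟩, rfl⟩
    exact ⟨q, hq, ladderMap_X_pow 𝕜 hq⟩
  · rintro ⟨q, hq, rfl⟩
    exact ⟨_, ⟨q, hq, rfl⟩, ladderMap_X_pow 𝕜 hq⟩

variable (M) in
/-- The homomorphism `z^q ↦ L_M^{(q)}`. -/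
def ladderHom : critRing 𝕜 M.partition →ₙ+* M.annihilatorRing 𝕜 where
  toFun p := ⟨ladderMap 𝕜 M p, by
    have h : ladderMap 𝕜 M p ∈ (critRing 𝕜 M.partition).toSubmodule.map (ladderMap 𝕜 M) :=
      ⟨p, p.2, rfl⟩
    rw [map_critRing] at h
    exact h⟩
  map_mul' f g := Subtype.ext (ladderMap_mul 𝕜 f.2 g.2)
  map_zero' := Subtype.ext (map_zero _)
  map_add' f g := Subtype.ext (map_add _ _ _)

theorem ladderHom_bijective : Function.Bijective (ladderHom 𝕜 M) := by
  constructor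
  · intro f g h
    have h₁ : ladderMap 𝕜 M (f - g) = 0 := by
      rw [map_sub, sub_eq_zero]
      exact congrArg Subtype.val h
    refine Subtype.ext (sub_eq_zero.1 (ladderMap_injOn 𝕜 (fun q hq => ?_) h₁))
    rw [← critDeg_partition]
    exact coeff_of_mem_critRing 𝕜 (sub_mem f.2 g.2) hq
  · rintro ⟨A, hA⟩
    have h : A ∈ (critRing 𝕜 M.partition).toSubmodule.map (ladderMap 𝕜 M) := by
      rw [map_critRing]
      exact hA
    obtain ⟨p, hp, rfl⟩ := h
    exact ⟨⟨p, hp⟩, rfl⟩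

variable (M) in
/-- The isomorphism from the ring of annihilators onto `R^{(λ)}`. -/
def annihilatorEquiv : M.annihilatorRing 𝕜 ≃+* critRing 𝕜 M.partition :=
  (RingEquiv.ofBijective (ladderHom 𝕜 M) (ladderHom_bijective 𝕜)).symm

theorem ladderHom_annihilatorEquiv (A : M.annihilatorRing 𝕜) :
    ladderHom 𝕜 M (annihilatorEquiv 𝕜 M A) = A :=
  (RingEquiv.ofBijective (ladderHom 𝕜 M) (ladderHom_bijective 𝕜)).apply_symm_apply A

end MayaDiagram

end MayaLadder

end

open MayaLadder
theorem mainTheorem3 (𝕜 : Type*) [RCLike 𝕜] (M : MayaDiagram) :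
    -- `D^{(λ)}` is the set of critical degrees of `M`, where `λ` is the partition of `M`
    critDeg M.partition = criticalDegrees M.carrier ∧
    -- for every critical degree the Wronskian in the denominator of `L_M^{(q)}` has no zero
    (∀ q ∈ critDeg M.partition,
      IsUnit (wr fun i : Fin (M.ladderSet (q : ℤ)).card =>
        M.psi 𝕜 ((M.ladderSet (q : ℤ)).orderEmbOfFin rfl i))) ∧
    -- action of the annihilators on the bound states
    (∀ q ∈ critDeg M.partition, ∀ m ∈ M.boundLabels,
      M.ladder 𝕜 (q : ℤ) (M.psi 𝕜 m) =
        ((2 : 𝕜) ^ q * M.gamma 𝕜 (q : ℤ) (m : 𝕜)) • M.psi 𝕜 (m - (q : ℤ))) ∧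
    -- the ring of annihilators is spanned by the `L_M^{(q)}` and is commutative
    (M.annihilatorRing 𝕜).toSubmodule =
      Submodule.span 𝕜 {A | ∃ q ∈ critDeg M.partition, A = M.ladder 𝕜 (q : ℤ)} ∧
    (∀ A ∈ M.annihilatorRing 𝕜, ∀ B ∈ M.annihilatorRing 𝕜, A * B = B * A) ∧
    -- it is isomorphic to `R^{(λ)}`, with `L_M^{(q)}` corresponding to `z^q`
    ∃ e : M.annihilatorRing 𝕜 ≃+* critRing 𝕜 M.partition,
      (∀ (c : 𝕜) (A : M.annihilatorRing 𝕜), e (c • A) = c • e A) ∧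
      ∀ q ∈ critDeg M.partition, ∀ A : M.annihilatorRing 𝕜,
        (A : Module.End 𝕜 (Smooth 𝕜 M.domain)) = M.ladder 𝕜 (q : ℤ) →
          (e A : Polynomial 𝕜) = Polynomial.X ^ q := by
  have hD := M.critDeg_partition
  refine ⟨hD, fun q hq => MayaDiagram.isUnit_ringWr_psi 𝕜 (hD ▸ hq),
    fun q hq m hm => MayaDiagram.ladder_psi 𝕜 (hD ▸ hq) hm,
    by rw [hD, MayaDiagram.toSubmodule_annihilatorRing],
    fun A hA B hB => ?_, MayaDiagram.annihilatorEquiv 𝕜 M, fun c A => ?_, fun q hq A hA => ?_⟩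
  -- Commutativity is transported from `𝕜[z]` along the surjective homomorphism.
  · obtain ⟨f, hf⟩ := (MayaDiagram.ladderHom_bijective 𝕜).2 (⟨A, hA⟩ : M.annihilatorRing 𝕜)
    obtain ⟨g, hg⟩ := (MayaDiagram.ladderHom_bijective 𝕜).2 (⟨B, hB⟩ : M.annihilatorRing 𝕜)
    have h : f * g = g * f := Subtype.ext (mul_comm (f : Polynomial 𝕜) g)
    have h₁ := congrArg (MayaDiagram.ladderHom 𝕜 M) h
    rw [map_mul, map_mul, hf, hg] at h₁
    exact congrArg Subtype.val h₁
  -- The bundled map records only sums and products; compatibility with scalars comes from linearity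
  -- of the underlying `ladderMap`.
  · apply (MayaDiagram.ladderHom_bijective 𝕜 (M := M)).1
    rw [MayaDiagram.ladderHom_annihilatorEquiv]
    refine Subtype.ext ?_
    have h₁ : MayaDiagram.ladderMap 𝕜 M (MayaDiagram.annihilatorEquiv 𝕜 M A : Polynomial 𝕜) = A :=
      congrArg Subtype.val (MayaDiagram.ladderHom_annihilatorEquiv 𝕜 A)
    change c • (A : Module.End 𝕜 (Smooth 𝕜 M.domain)) =
      MayaDiagram.ladderMap 𝕜 M (c • (MayaDiagram.annihilatorEquiv 𝕜 M A : Polynomial 𝕜))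
    rw [map_smul, h₁]
  · have h₀ : Polynomial.X ^ q ∈ critRing 𝕜 M.partition :=
      Submodule.subset_span (s := {p : Polynomial 𝕜 | ∃ q ∈ critDeg M.partition,
        p = Polynomial.X ^ q}) ⟨q, hq, rfl⟩
    have h₁ : MayaDiagram.annihilatorEquiv 𝕜 M A = ⟨Polynomial.X ^ q, h₀⟩ := by
      apply (MayaDiagram.ladderHom_bijective 𝕜 (M := M)).1
      rw [MayaDiagram.ladderHom_annihilatorEquiv]
      exact Subtype.ext (hA.trans (MayaDiagram.ladderMap_X_pow 𝕜 (hD ▸ hq)).symm)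
    rw [h₁]
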